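/- Let $G$ be a simple connected graph on the vertex set $[n]=\{1,\dots,n\}$ and let $\beta(G)=|E(G)|-(n-1)$ be its first Betti number. Let $\mathcal S(G)$ be the space of real symmetric $n\times n$ matrices $A$ with $A_{ij}=0$ whenever $i\neq j$ and $(ij)\notin E(G)$ (the diagonal is arbitrary). We say that $A\in\mathcal S(G)$ satisfies the Nodal Count Condition (NCC) if $A_{ij}\ne 0$ for every edge $(ij)\in E(G)$, all eigenvalues of $A$ are simple, and no eigenvector of $A$ has a zero entry. In this case let $\lambda_1<\dots<\lambda_n$ be the eigenvalues of $A$, let $\varphi_1,\dots,\varphi_n$ be the corresponding normalized eigenvectors, and put \[\nu(A,\varphi_k)=\bigl|\{\,i<j : A_{ij}\,\varphi_k(i)\,\varphi_k(j)>0\,\}\bigr| .\] **Theorem 1.1.** If $G$ is a simple connected graph on $n$ vertices and $A\in\mathcal S(G)$ satisfies (NCC), then the average nodal surplus satisfies \[\frac{\beta(G)}{n}\le\frac1n\sum_{k=1}^n\bigl[\nu(A,\varphi_k)-(k-1)\bigr]\le\beta(G)-\frac{\beta(G)}{n},\] and, equivalently, the average nodal count satisfies \[\frac{n-1}{2}+\frac{\beta(G)}{n}\le\frac1n\sum_{k=1}^n\nu(A,\varphi_k)\le\frac{n-1}{2}+\beta(G)-\frac{\beta(G)}{n}.\]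 Moreover, these bounds are tight. For integers $n\ge1$ and $0\le\beta\le\binom{n-1}{2}$, define a graph $G_{n,\beta}$ on $[n]$ as follows. If $\beta=0$, it is the path $1-2-\cdots-n$. If $\beta>0$, let $m$ be the integer with $\binom{m-2}{2}<\beta\le\binom{m-1}{2}$, let $\ell=\binom{m-1}{2}-\beta$, and let the edge set be \[\{(1,i):\ell+1<i\le m\}\cup\{(i,j):1<i<j\le m\}\cup\{(i,i+1):m\le i<n\}\] (an $m$-clique with $\ell$ edges at vertex $1$ removed, attached to a path). Then $G_{n,\beta}$ is connected, $\beta(G_{n,\beta})=\beta$, and there is a matrix $A\in\mathcal S(G_{n,\beta})$ satisfying (NCC) whose average nodal surplus equals $\beta/n$; moreover $-A$ also satisfies (NCC), and its average nodal surplus equals $\beta-\beta/n$. -/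

import Mathlib

namespace NodalCount

/-- The first Betti number `|E(G)| - (n - 1)` of a (connected) graph on `n` vertices. -/
noncomputable def betti {n : ℕ} (G : SimpleGraph (Fin n)) : ℤ :=
  (G.edgeSet.ncard : ℤ) - ((n : ℤ) - 1)

/-- The vector space of real symmetric matrices supported on `G`: off-diagonal entries vanish
outside the edges, and the diagonal is arbitrary. -/
def supportedMatrices {n : ℕ} (G : SimpleGraph (Fin n)) :
    Submodule ℝ (Matrix (Fin n) (Fin n) ℝ) where
  carrier := {A | A.IsSymm ∧ ∀ i j, i ≠ j → ¬ G.Adj i j → A i j = 0}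
  add_mem' := fun {A B} hA hB =>
    ⟨hA.1.add hB.1, fun i j hij h => by
      rw [Matrix.add_apply, hA.2 i j hij h, hB.2 i j hij h, add_zero]⟩
  zero_mem' := ⟨Matrix.isSymm_zero, fun _ _ _ _ => rfl⟩
  smul_mem' := fun c A hA =>
    ⟨hA.1.smul c, fun i j hij h => by
      rw [Matrix.smul_apply, hA.2 i j hij h, smul_zero]⟩

/-- `A` is strictly supported on `G`. -/
def IsStrictlySupported {n : ℕ} (G : SimpleGraph (Fin n)) (A : Matrix (Fin n) (Fin n) ℝ) : Prop :=
  A ∈ supportedMatrices G ∧ ∀ i j, G.Adj i j → A i j ≠ 0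

/-- The nodal count condition: `A` is strictly supported on `G`, all its eigenvalues are simple,
and all its eigenvectors are nowhere vanishing. -/
structure NCC {n : ℕ} (G : SimpleGraph (Fin n)) (A : Matrix (Fin n) (Fin n) ℝ) : Prop where
  strictlySupported : IsStrictlySupported G A
  simple : ∀ μ : ℝ, Module.End.HasEigenvalue (Matrix.toLin' A) μ →
    Module.finrank ℝ (Module.End.eigenspace (Matrix.toLin' A) μ) = 1
  nowhereVanishing : ∀ (μ : ℝ) (v : Fin n → ℝ),
    Module.End.HasEigenvector (Matrix.toLin' A) μ v → ∀ i, v i ≠ 0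

/-- `lam 0 ≤ lam 1 ≤ … ≤ lam (n-1)` are the eigenvalues of `A` in non-decreasing order, and `φ` is
a corresponding orthonormal basis of eigenvectors. (If the eigenvalues are simple, `lam` is unique
and each `φ k` is unique up to sign.) -/
structure IsOrderedEigenbasis {n : ℕ} (A : Matrix (Fin n) (Fin n) ℝ) (lam : Fin n → ℝ)
    (φ : Fin n → Fin n → ℝ) : Prop where
  monotone : Monotone lam
  orthonormal : ∀ j k, φ j ⬝ᵥ φ k = if j = k then 1 else 0
  eigen : ∀ k, A.mulVec (φ k) = lam k • φ k

/-- The nodal (edge) count `ν(A, v)`, the number of pairs `i < j` with `A i j * v i * v j > 0`. -/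
noncomputable def nodalCount {n : ℕ} (A : Matrix (Fin n) (Fin n) ℝ) (v : Fin n → ℝ) : ℕ :=
  (Finset.univ.filter fun p : Fin n × Fin n => p.1 < p.2 ∧ 0 < A p.1 p.2 * v p.1 * v p.2).card

/-- The average nodal count `(1/n) ∑ₖ ν(A, φₖ)`. -/
noncomputable def averageNodalCount {n : ℕ} (A : Matrix (Fin n) (Fin n) ℝ)
    (φ : Fin n → Fin n → ℝ) : ℝ :=
  (1 / (n : ℝ)) * ∑ k, (nodalCount A (φ k) : ℝ)

/-- The average nodal surplus `(1/n) ∑ₖ (ν(A, φₖ) - (k - 1))`; the index `k` of `Fin n` starts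
at `0`, so that its value plays the role of `k - 1`. -/
noncomputable def averageNodalSurplus {n : ℕ} (A : Matrix (Fin n) (Fin n) ℝ)
    (φ : Fin n → Fin n → ℝ) : ℝ :=
  (1 / (n : ℝ)) * ∑ k, ((nodalCount A (φ k) : ℝ) - ((k : ℕ) : ℝ))

/-- The graph on the vertices `1, …, n` (vertex `i` is the element `i - 1` of `Fin n`) with edges
`(1,i)` for `ℓ + 1 < i ≤ m`, `(i,j)` for `1 < i < j ≤ m`, and `(i,i+1)` for `m ≤ i < n`:
a clique on `m` vertices with `ℓ` edges at the vertex `1` removed, attached to a path. -/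
def cliquePath (n m l : ℕ) : SimpleGraph (Fin n) :=
  SimpleGraph.fromRel fun a b =>
    ((a : ℕ) + 1 = 1 ∧ l + 1 < (b : ℕ) + 1 ∧ (b : ℕ) + 1 ≤ m) ∨
    (1 < (a : ℕ) + 1 ∧ (a : ℕ) + 1 < (b : ℕ) + 1 ∧ (b : ℕ) + 1 ≤ m) ∨
    (m ≤ (a : ℕ) + 1 ∧ (b : ℕ) + 1 = ((a : ℕ) + 1) + 1)

/-- The least `m` with `β ≤ (m-1).choose 2`. -/
noncomputable def cliqueSize (β : ℕ) : ℕ := sInf {m : ℕ | β ≤ (m - 1).choose 2}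

theorem le_choose_cliqueSize (β : ℕ) : β ≤ (cliqueSize β - 1).choose 2 := by
  refine Nat.sInf_mem (s := {m : ℕ | β ≤ (m - 1).choose 2}) ⟨β + 2, ?_⟩
  change β ≤ (β + 1).choose 2
  have h := Nat.choose_succ_succ β 1
  simp only [Nat.choose_one_right] at h
  exact h ▸ Nat.le_add_right _ _

/-- For `0 < β` the clique size is the unique `m` with
`(m-2).choose 2 < β ≤ (m-1).choose 2`. -/
theorem choose_cliqueSize_lt {β : ℕ} (hβ : 0 < β) : (cliqueSize β - 2).choose 2 < β := by
  have h1 : cliqueSize β ≠ 0 := by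
    intro h
    have := le_choose_cliqueSize β
    rw [h] at this
    simp at this
    omega
  have h2 := Nat.notMem_of_lt_sInf (s := {m : ℕ | β ≤ (m - 1).choose 2}) (m := cliqueSize β - 1)
    (by change cliqueSize β - 1 < cliqueSize β; omega)
  simpa [Nat.sub_sub] using h2

/-- The extremizer graph `G_{n,β}`, with `m` such that `(m-2).choose 2 < β ≤ (m-1).choose 2` and
`ℓ = (m-1).choose 2 - β`. For `β = 0` it is the path on `n` vertices. -/
noncomputable def extremizer (n β : ℕ) : SimpleGraph (Fin n) :=
  cliquePath n (cliqueSize β) ((cliqueSize β - 1).choose 2 - β)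

end NodalCount

open NodalCount

/-! Lower bound. Let α be a real function on the edges. For each k take a gauge function f_k on the
vertices and consider the edge form Σ_{i<j} A_ij φ_k(i) φ_k(j) (α_ij − (f_k(j) − f_k(i)))². Summed
over k, the pure α² terms cancel, because the rows of an orthogonal matrix are orthogonal. Write φ_k
f_k = Σ_l γ_kl φ_l. The rest is then Σ_{k,l} (2 γ_kl b_lk − γ_kl² (λ_l − λ_k)), where b is the
antisymmetric matrix of α in the eigenbasis. With γ_kl = c_kl + b_lk/(λ_l − λ_k) off the diagonal
and c strictly lower triangular, completing the square leaves Σ b_lk²/(λ_l − λ_k), which is zero by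
antisymmetry, plus Σ_{l<k} c_kl² (λ_k − λ_l) ≥ 0 (`sum_gaugedEdge`). This form is nonpositive once
the corrected edge functions vanish on the edges counted by ν. Requiring in addition that one gauge
function be constant costs n − 1 conditions and forces α = 0 and c = 0. Comparing dimensions gives
|E| + n(n−1)/2 ≤ Σ ν + n − 1 (`edges_add_le_sum_nodalCount`), the lower bound. The upper bound is
the lower bound for −A, since ν(A, v) + ν(−A, v) = |E|.

Tightness. The graph is built vertex by vertex, each new vertex coupled weakly to the old ones, with
A negative on edges so that ν counts sign changes. Perturbation theory
(`IsSimpleEigenbasis.exists_border`) gives all signs: old eigenvectors keep theirs, at the new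
vertex they have the sign of (λ_k − d)⟨φ_k, a⟩, and the new eigenvector looks like (d − A)⁻¹ a. If d
lies above the spectrum and a is concentrated on a root r, the new vertex copies the sign of r in
every old eigenvector. If moreover each vertex other than r disagrees with r in exactly one
eigenvector, then attaching to N adds |N| − 1 sign changes to the old eigenvectors, exactly the
growth of β, while the new top eigenvector can be arranged to have surplus 0. This gives cliques
(`RootedClique.option`) and cliques with edges removed at one vertex (`RootedClique.extremal`). A
pendant vertex is attached with d below the spectrum: each old eigenvector moves up one index and
gains one sign change, and the new ground state has none (`Extremal.pendant`). -/

open Filter Topology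

/-! ### Orthogonality of rows, and the edge form of an eigenvector -/

/-- The rows of a square matrix with orthonormal columns are orthonormal. -/
theorem sum_mul_eq_of_orthonormal {V : Type*} [Fintype V] [DecidableEq V] {φ : V → V → ℝ}
    (h : ∀ j k, φ j ⬝ᵥ φ k = if j = k then 1 else 0) (i j : V) :
    ∑ k, φ k i * φ k j = if i = j then 1 else 0 := by
  have h1 : (Matrix.of φ) * (Matrix.of φ).transpose = 1 := by
    ext j k
    simpa [Matrix.mul_apply, Matrix.one_apply, dotProduct] using h j k
  have h2 := congrArg (fun M : Matrix V V ℝ => M i j) (mul_eq_one_comm.mp h1)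
  simpa [Matrix.mul_apply, Matrix.one_apply] using h2

/-- Sum over pairs `i < j` as half a sum over all pairs, for a symmetric summand which vanishes
on the diagonal. -/
theorem two_mul_sum_lt {n : ℕ} (g : Fin n → Fin n → ℝ) (hs : ∀ i j, g i j = g j i)
    (hd : ∀ i, g i i = 0) :
    2 * ∑ p : Fin n × Fin n, (if p.1 < p.2 then g p.1 p.2 else 0) = ∑ i, ∑ j, g i j := by
  have h1 : ∑ p : Fin n × Fin n, (if p.1 < p.2 then g p.1 p.2 else 0)
      = ∑ p : Fin n × Fin n, (if p.2 < p.1 then g p.1 p.2 else 0) := by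
    rw [← Equiv.sum_comp (Equiv.prodComm _ _)]
    exact Finset.sum_congr rfl fun p _ => by simp [hs]
  rw [two_mul]
  nth_rewrite 2 [h1]
  rw [← Finset.sum_add_distrib, ← Fintype.sum_prod_type']
  refine Finset.sum_congr rfl fun p _ => ?_
  rcases lt_trichotomy p.1 p.2 with h | h | h
  · simp [h, h.asymm]
  · simp [h, hd]
  · simp [h, h.asymm]

/-- The edge form of `A - μ` in the coordinates `f = u / v`, where `A v = μ v`. -/
theorem sum_lt_mul_sq_sub {n : ℕ} {A : Matrix (Fin n) (Fin n) ℝ} (hA : A.IsSymm) {μ : ℝ}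
    {v : Fin n → ℝ} (hv : A.mulVec v = μ • v) (f : Fin n → ℝ) :
    ∑ p : Fin n × Fin n, (if p.1 < p.2 then A p.1 p.2 * v p.1 * v p.2 * (f p.2 - f p.1) ^ 2 else 0)
      = μ * ∑ i, (v i * f i) ^ 2 - (fun i => v i * f i) ⬝ᵥ A.mulVec (fun i => v i * f i) := by
  have h1 := two_mul_sum_lt (fun i j => A i j * v i * v j * (f j - f i) ^ 2)
    (fun i j => by rw [hA.apply i j]; ring) (fun i => by ring)
  have h2 : ∀ i, ∑ j, A i j * v j = μ * v i := fun i => by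
    simpa [Matrix.mulVec, dotProduct] using congrFun hv i
  have h3 : ∑ i, ∑ j, A i j * v i * v j * (f i) ^ 2 = μ * ∑ i, (v i * f i) ^ 2 := by
    rw [Finset.mul_sum]
    refine Finset.sum_congr rfl fun i _ => ?_
    have : ∑ j, A i j * v i * v j * (f i) ^ 2 = v i * (f i) ^ 2 * ∑ j, A i j * v j := by
      rw [Finset.mul_sum]; exact Finset.sum_congr rfl fun j _ => by ring
    rw [this, h2]; ring
  have h4 : ∑ i, ∑ j, A i j * v i * v j * (f j) ^ 2 = μ * ∑ i, (v i * f i) ^ 2 := by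
    rw [← h3, Finset.sum_comm]
    exact Finset.sum_congr rfl fun i _ => Finset.sum_congr rfl fun j _ => by
      rw [hA.apply j i]; ring
  have h5 : ∑ i, ∑ j, A i j * v i * v j * (f i * f j)
      = (fun i => v i * f i) ⬝ᵥ A.mulVec (fun i => v i * f i) := by
    simp only [dotProduct, Matrix.mulVec, Finset.mul_sum]
    exact Finset.sum_congr rfl fun i _ => Finset.sum_congr rfl fun j _ => by ring
  have h6 : ∑ i, ∑ j, A i j * v i * v j * (f j - f i) ^ 2
      = ∑ i, ∑ j, A i j * v i * v j * (f i) ^ 2 + ∑ i, ∑ j, A i j * v i * v j * (f j) ^ 2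
        - 2 * ∑ i, ∑ j, A i j * v i * v j * (f i * f j) := by
    simp only [Finset.mul_sum, ← Finset.sum_add_distrib, ← Finset.sum_sub_distrib]
    exact Finset.sum_congr rfl fun i _ => Finset.sum_congr rfl fun j _ => by ring
  rw [h6, h3, h4, h5] at h1
  linarith

/-- The pairs `i < j` with `A i j ≠ 0`. -/
abbrev EdgePair {n : ℕ} (A : Matrix (Fin n) (Fin n) ℝ) : Type :=
  {p : Fin n × Fin n // p.1 < p.2 ∧ A p.1 p.2 ≠ 0}

theorem sum_edgePair {n : ℕ} (A : Matrix (Fin n) (Fin n) ℝ) (g : Fin n × Fin n → ℝ)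
    (hg : ∀ p, A p.1 p.2 = 0 → g p = 0) :
    ∑ e : EdgePair A, g e.1 = ∑ p : Fin n × Fin n, if p.1 < p.2 then g p else 0 := by
  classical
  rw [← Finset.sum_filter, ← Finset.sum_subtype (Finset.univ.filter
    fun p : Fin n × Fin n => p.1 < p.2 ∧ A p.1 p.2 ≠ 0) (by simp) g]
  refine Finset.sum_subset (fun p hp => by simp at hp ⊢; exact hp.1) fun p hp hp' => hg p ?_
  simp only [Finset.mem_filter, Finset.mem_univ, true_and, not_and, not_not] at hp hp'
  exact hp' hp

/-! ### The gauged quadratic form and the dimension count -/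

section Form

variable {n : ℕ} {A : Matrix (Fin n) (Fin n) ℝ} {lam : Fin n → ℝ} {φ : Fin n → Fin n → ℝ}

/-- The matrix, in the basis `φ`, of the antisymmetric matrix obtained from `A` by multiplying the
entries by the antisymmetric edge function `α`. -/
noncomputable def magneticForm (A : Matrix (Fin n) (Fin n) ℝ) (φ : Fin n → Fin n → ℝ) :
    (EdgePair A → ℝ) →ₗ[ℝ] (Fin n → Fin n → ℝ) where
  toFun α l k := ∑ e, α e * (A e.1.1 e.1.2 * (φ l e.1.1 * φ k e.1.2 - φ l e.1.2 * φ k e.1.1))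
  map_add' α β := by
    ext l k
    simp [add_mul, Finset.sum_add_distrib]
  map_smul' c α := by
    ext l k
    simp [Finset.mul_sum, mul_assoc]

/-- Coefficients of the gauge function at `φ k`: the critical gauge of `α` plus the perturbation
`c` below the diagonal. -/
noncomputable def gaugeCoeff (A : Matrix (Fin n) (Fin n) ℝ) (lam : Fin n → ℝ)
    (φ : Fin n → Fin n → ℝ) :
    ((EdgePair A → ℝ) × ({p : Fin n × Fin n // p.2 < p.1} → ℝ)) →ₗ[ℝ] (Fin n → Fin n → ℝ) where
  -- The quotient is the stationary point of γ ↦ 2 γ b − γ² (λ_l − λ_k). For l = k it is read as 0.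
  toFun x k l := (if h : l < k then x.2 ⟨(k, l), h⟩ else 0)
    + magneticForm A φ x.1 l k / (lam l - lam k)
  map_add' x y := by
    ext k l
    simp only [Prod.snd_add, Prod.fst_add, map_add, Pi.add_apply]
    split_ifs <;> ring
  map_smul' c x := by
    ext k l
    simp only [Prod.smul_snd, Prod.smul_fst, map_smul, Pi.smul_apply, smul_eq_mul,
      RingHom.id_apply]
    split_ifs <;> ring

/-- The gauge function at `φ k` with the coefficients `gaugeCoeff`, divided by `φ k`. -/
noncomputable def gaugeFn (A : Matrix (Fin n) (Fin n) ℝ) (lam : Fin n → ℝ)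
    (φ : Fin n → Fin n → ℝ) :
    ((EdgePair A → ℝ) × ({p : Fin n × Fin n // p.2 < p.1} → ℝ)) →ₗ[ℝ] (Fin n → Fin n → ℝ) where
  toFun x k i := (∑ l, gaugeCoeff A lam φ x k l * φ l i) / φ k i
  map_add' x y := by
    ext k i
    simp [add_mul, Finset.sum_add_distrib, add_div]
  map_smul' c x := by
    ext k i
    simp [mul_assoc, ← Finset.mul_sum, mul_div_assoc]

/-- The edge function `α` corrected by the coboundary of the gauge function at `φ k`. -/
noncomputable def gaugedEdge (A : Matrix (Fin n) (Fin n) ℝ) (lam : Fin n → ℝ)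
    (φ : Fin n → Fin n → ℝ) :
    ((EdgePair A → ℝ) × ({p : Fin n × Fin n // p.2 < p.1} → ℝ)) →ₗ[ℝ]
      (Fin n → EdgePair A → ℝ) where
  toFun x k e := x.1 e - (gaugeFn A lam φ x k e.1.2 - gaugeFn A lam φ x k e.1.1)
  map_add' x y := by
    ext k i
    simp only [Prod.fst_add, map_add, Pi.add_apply]
    ring
  map_smul' c x := by
    ext k i
    simp only [Prod.smul_fst, map_smul, Pi.smul_apply, smul_eq_mul, RingHom.id_apply]
    ring

theorem magneticForm_antisymm (α : EdgePair A → ℝ) (l k : Fin n) :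
    magneticForm A φ α l k = - magneticForm A φ α k l := by
  simp only [magneticForm, LinearMap.coe_mk, AddHom.coe_mk, ← Finset.sum_neg_distrib]
  exact Finset.sum_congr rfl fun e _ => by ring

theorem quadratic_eigen_expansion (horth : ∀ j k, φ j ⬝ᵥ φ k = if j = k then 1 else 0)
    (heig : ∀ k, A.mulVec (φ k) = lam k • φ k) (γ : Fin n → ℝ) (μ : ℝ) :
    μ * ∑ i, (∑ l, γ l * φ l i) ^ 2
      - (fun i => ∑ l, γ l * φ l i) ⬝ᵥ A.mulVec (fun i => ∑ l, γ l * φ l i)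
      = - ∑ l, γ l ^ 2 * (lam l - μ) := by
  have h0 : (fun i => ∑ l, γ l * φ l i) = ∑ l, γ l • φ l := by
    ext i; simp
  have h1 : A.mulVec (∑ l, γ l • φ l) = ∑ l, (γ l * lam l) • φ l := by
    rw [Matrix.mulVec_sum]
    exact Finset.sum_congr rfl fun l _ => by rw [Matrix.mulVec_smul, heig, smul_smul]
  have h2 : ∀ a b : Fin n → ℝ, (∑ l, a l • φ l) ⬝ᵥ (∑ l, b l • φ l) = ∑ l, a l * b l := by
    intro a b
    simp [sum_dotProduct, dotProduct_sum, horth, mul_comm]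
  have h3 : ∑ i, (∑ l, γ l * φ l i) ^ 2 = (∑ l, γ l • φ l) ⬝ᵥ (∑ l, γ l • φ l) := by
    rw [← h0]; simp [dotProduct, sq]
  rw [h3, h0, h1, h2, h2, Finset.mul_sum, ← Finset.sum_sub_distrib, ← Finset.sum_neg_distrib]
  exact Finset.sum_congr rfl fun l _ => by ring

/-- The total edge form of the gauged edge functions. -/
theorem sum_gaugedEdge (hA : A.IsSymm) (hlam : Function.Injective lam)
    (horth : ∀ j k, φ j ⬝ᵥ φ k = if j = k then 1 else 0)
    (heig : ∀ k, A.mulVec (φ k) = lam k • φ k) (hnz : ∀ k i, φ k i ≠ 0)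
    (x : (EdgePair A → ℝ) × ({p : Fin n × Fin n // p.2 < p.1} → ℝ)) :
    ∑ k, ∑ e : EdgePair A,
        A e.1.1 e.1.2 * φ k e.1.1 * φ k e.1.2 * (gaugedEdge A lam φ x k e) ^ 2
      = - ∑ p : {p : Fin n × Fin n // p.2 < p.1}, x.2 p ^ 2 * (lam p.1.2 - lam p.1.1) := by
  set b := magneticForm A φ x.1 with hb
  set γ := gaugeCoeff A lam φ x with hγ
  set f := gaugeFn A lam φ x with hf
  have hbk : ∀ k, b k k = 0 := fun k => by
    have := magneticForm_antisymm (φ := φ) x.1 k k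
    rw [← hb] at this; linarith
  have hfu : ∀ k i, φ k i * f k i = ∑ l, γ k l * φ l i := fun k i => by
    simp only [hf, gaugeFn, LinearMap.coe_mk, AddHom.coe_mk]
    field_simp [hnz k i]
    simp [hγ]
  have hquad : ∀ k, ∑ e : EdgePair A,
      A e.1.1 e.1.2 * φ k e.1.1 * φ k e.1.2 * (f k e.1.2 - f k e.1.1) ^ 2
      = - ∑ l, γ k l ^ 2 * (lam l - lam k) := fun k => by
    rw [sum_edgePair A (fun p => A p.1 p.2 * φ k p.1 * φ k p.2 * (f k p.2 - f k p.1) ^ 2)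
      (fun p hp => by simp [hp]), sum_lt_mul_sq_sub hA (heig k)]
    simp only [hfu]
    exact quadratic_eigen_expansion horth heig _ _
  have hcross : ∀ k, ∑ e : EdgePair A,
      A e.1.1 e.1.2 * φ k e.1.1 * φ k e.1.2 * (x.1 e * (f k e.1.2 - f k e.1.1))
      = - ∑ l, γ k l * b l k := fun k => by
    have : ∀ e : EdgePair A,
        A e.1.1 e.1.2 * φ k e.1.1 * φ k e.1.2 * (x.1 e * (f k e.1.2 - f k e.1.1))
        = x.1 e * A e.1.1 e.1.2 * (φ k e.1.1 * (∑ l, γ k l * φ l e.1.2)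
          - φ k e.1.2 * (∑ l, γ k l * φ l e.1.1)) := fun e => by
      rw [← hfu, ← hfu]; ring
    simp only [this]
    simp only [hb, magneticForm, LinearMap.coe_mk, AddHom.coe_mk, Finset.mul_sum,
      ← Finset.sum_sub_distrib]
    rw [Finset.sum_comm, ← Finset.sum_neg_distrib]
    refine Finset.sum_congr rfl fun l _ => ?_
    rw [← Finset.sum_neg_distrib]
    exact Finset.sum_congr rfl fun e _ => by ring
  -- For a fixed edge (i, j) the sum over k is a multiple of Σ_k φ_k(i) φ_k(j), which is 0 as i ≠ j.
  have hdiag : ∑ k, ∑ e : EdgePair A, A e.1.1 e.1.2 * φ k e.1.1 * φ k e.1.2 * (x.1 e) ^ 2 = 0 := by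
    rw [Finset.sum_comm]
    refine Finset.sum_eq_zero fun e _ => ?_
    have h1 := sum_mul_eq_of_orthonormal horth e.1.1 e.1.2
    rw [if_neg e.2.1.ne] at h1
    have : ∑ k, A e.1.1 e.1.2 * φ k e.1.1 * φ k e.1.2 * (x.1 e) ^ 2
        = A e.1.1 e.1.2 * (x.1 e) ^ 2 * ∑ k, φ k e.1.1 * φ k e.1.2 := by
      rw [Finset.mul_sum]; exact Finset.sum_congr rfl fun k _ => by ring
    rw [this, h1, mul_zero]
  set c : Fin n → Fin n → ℝ := fun k l => if h : l < k then x.2 ⟨(k, l), h⟩ else 0 with hc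
  have hγb : ∀ k l, γ k l = c k l + b l k / (lam l - lam k) := fun k l => rfl
  -- Swapping k and l preserves b² and reverses the denominator.
  have hanti : ∑ k, ∑ l, b l k ^ 2 / (lam l - lam k) = 0 := by
    have h1 : ∑ k, ∑ l, b l k ^ 2 / (lam l - lam k)
        = - ∑ k, ∑ l, b l k ^ 2 / (lam l - lam k) := by
      conv_lhs => rw [Finset.sum_comm]
      simp only [← Finset.sum_neg_distrib]
      refine Finset.sum_congr rfl fun k _ => Finset.sum_congr rfl fun l _ => ?_
      rw [hb, magneticForm_antisymm x.1 k l, ← neg_sub (lam l), div_neg, neg_sq]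
    linarith
  have hsum : ∑ k, ∑ e : EdgePair A,
        A e.1.1 e.1.2 * φ k e.1.1 * φ k e.1.2 * (gaugedEdge A lam φ x k e) ^ 2
      = ∑ k, ∑ e : EdgePair A, A e.1.1 e.1.2 * φ k e.1.1 * φ k e.1.2 * (x.1 e) ^ 2
        + ∑ k, ∑ l, (2 * (γ k l * b l k) - γ k l ^ 2 * (lam l - lam k)) := by
    rw [← Finset.sum_add_distrib]
    refine Finset.sum_congr rfl fun k _ => ?_
    have h1 := hquad k
    have h2 := hcross k
    rw [Finset.sum_sub_distrib, ← Finset.mul_sum]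
    have h3 : ∑ e : EdgePair A,
        A e.1.1 e.1.2 * φ k e.1.1 * φ k e.1.2 * (gaugedEdge A lam φ x k e) ^ 2
        = ∑ e : EdgePair A, A e.1.1 e.1.2 * φ k e.1.1 * φ k e.1.2 * (x.1 e) ^ 2
        - 2 * ∑ e : EdgePair A,
          A e.1.1 e.1.2 * φ k e.1.1 * φ k e.1.2 * (x.1 e * (f k e.1.2 - f k e.1.1))
        + ∑ e : EdgePair A,
          A e.1.1 e.1.2 * φ k e.1.1 * φ k e.1.2 * (f k e.1.2 - f k e.1.1) ^ 2 := by
      rw [Finset.mul_sum, ← Finset.sum_sub_distrib, ← Finset.sum_add_distrib]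
      refine Finset.sum_congr rfl fun e _ => ?_
      simp only [gaugedEdge, LinearMap.coe_mk, AddHom.coe_mk, ← hf]
      ring
    rw [h3, h1, h2]; ring
  rw [hsum, hdiag, zero_add]
  -- Completing the square. On the diagonal both sides vanish because b k k = 0.
  have hterm : ∀ k l, 2 * (γ k l * b l k) - γ k l ^ 2 * (lam l - lam k)
      = b l k ^ 2 / (lam l - lam k) - c k l ^ 2 * (lam l - lam k) := by
    intro k l
    rw [hγb]
    by_cases h : l = k
    · subst h; simp [hbk]
    · have : lam l - lam k ≠ 0 := sub_ne_zero.mpr fun h' => h (hlam h')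
      field_simp
      ring
  simp only [hterm, Finset.sum_sub_distrib, hanti, zero_sub]
  congr 1
  rw [← Fintype.sum_prod_type' (f := fun k l => c k l ^ 2 * (lam l - lam k)),
    ← Finset.sum_subset (Finset.subset_univ (Finset.univ.filter fun p : Fin n × Fin n => p.2 < p.1))
      (fun p _ hp => by
        have : ¬ p.2 < p.1 := by simpa using hp
        simp [hc, this])]
  rw [Finset.sum_subtype (p := fun p : Fin n × Fin n => p.2 < p.1) _ (by simp)]
  refine Finset.sum_congr rfl fun p _ => ?_
  simp only [hc, dif_pos p.2]

/-- The edge functions together with the strictly lower triangular coefficients inject into the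
product of the edges with positive sign and the gauge functions modulo constants. -/
theorem edges_add_le_sum_nodalCount [NeZero n] (hA : A.IsSymm) (hlam : StrictMono lam)
    (horth : ∀ j k, φ j ⬝ᵥ φ k = if j = k then 1 else 0)
    (heig : ∀ k, A.mulVec (φ k) = lam k • φ k) (hnz : ∀ k i, φ k i ≠ 0) :
    Fintype.card (EdgePair A) + Fintype.card {p : Fin n × Fin n // p.2 < p.1}
      ≤ ∑ k, nodalCount A (φ k) + (n - 1) := by
  classical
  let P := {q : Fin n × EdgePair A // 0 < A q.2.1.1 q.2.1.2 * φ q.1 q.2.1.1 * φ q.1 q.2.1.2}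
  let T : ((EdgePair A → ℝ) × ({p : Fin n × Fin n // p.2 < p.1} → ℝ)) →ₗ[ℝ]
      ((P → ℝ) × ({i : Fin n // i ≠ 0} → ℝ)) :=
    { toFun := fun x => (fun q => gaugedEdge A lam φ x q.1.1 q.1.2,
        fun i => gaugeFn A lam φ x 0 i - gaugeFn A lam φ x 0 0)
      map_add' := fun x y => by
        ext i
        · simp
        · simp; ring
      map_smul' := fun c x => by
        ext i
        · simp
        · simp; ring }
  -- On the kernel every term of the form is nonpositive, while the total is a sum of nonnegative
  -- terms in c. Hence all terms on both sides vanish.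
  have hinj : Function.Injective T := by
    rw [injective_iff_map_eq_zero]
    intro x hx
    have hx1 : ∀ k e, 0 < A e.1.1 e.1.2 * φ k e.1.1 * φ k e.1.2 → gaugedEdge A lam φ x k e = 0 :=
      fun k e h => congrFun (congrArg Prod.fst hx) ⟨(k, e), h⟩
    have hx2 : ∀ i, gaugeFn A lam φ x 0 i = gaugeFn A lam φ x 0 0 := fun i => by
      by_cases h : i = 0
      · rw [h]
      · exact sub_eq_zero.mp (congrFun (congrArg Prod.snd hx) ⟨i, h⟩)
    have hle : ∀ k, ∀ e : EdgePair A,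
        A e.1.1 e.1.2 * φ k e.1.1 * φ k e.1.2 * (gaugedEdge A lam φ x k e) ^ 2 ≤ 0 := by
      intro k e
      rcases lt_or_ge 0 (A e.1.1 e.1.2 * φ k e.1.1 * φ k e.1.2) with h | h
      · simp [hx1 k e h]
      · exact mul_nonpos_of_nonpos_of_nonneg h (sq_nonneg _)
    have hge : ∀ p : {p : Fin n × Fin n // p.2 < p.1},
        0 ≤ -(x.2 p ^ 2 * (lam p.1.2 - lam p.1.1)) := fun p => by
      have := hlam p.2
      nlinarith [sq_nonneg (x.2 p)]
    have hform := sum_gaugedEdge hA hlam.injective horth heig hnz x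
    rw [← Finset.sum_neg_distrib] at hform
    have h0 : ∑ p : {p : Fin n × Fin n // p.2 < p.1}, -(x.2 p ^ 2 * (lam p.1.2 - lam p.1.1)) = 0 :=
      le_antisymm (hform ▸ Finset.sum_nonpos fun k _ => Finset.sum_nonpos fun e _ => hle k e)
        (Finset.sum_nonneg fun p _ => hge p)
    have hx3 : x.2 = 0 := by
      ext p
      have := (Finset.sum_eq_zero_iff_of_nonneg fun p _ => hge p).mp h0 p (Finset.mem_univ _)
      have h1 := hlam p.2
      have h2 : lam p.1.2 - lam p.1.1 ≠ 0 := by linarith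
      simpa [h2] using this
    rw [h0] at hform
    -- At the eigenvector with index 0 the gauge function is constant, so the corrected edge
    -- function is α itself, and its coefficient A_ij φ_0(i) φ_0(j) is nonzero on every edge.
    have hx4 : x.1 = 0 := by
      ext e
      have h1 := (Finset.sum_eq_zero_iff_of_nonpos
        fun k _ => Finset.sum_nonpos fun e _ => hle k e).mp hform 0 (Finset.mem_univ _)
      have h2 := (Finset.sum_eq_zero_iff_of_nonpos fun e _ => hle 0 e).mp h1 e (Finset.mem_univ _)
      have h3 : gaugedEdge A lam φ x 0 e = 0 := by
        simpa [e.2.2, hnz] using h2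
      simp only [gaugedEdge, LinearMap.coe_mk, AddHom.coe_mk] at h3
      rw [hx2, hx2 e.1.1] at h3
      simpa using h3
    exact Prod.ext hx4 hx3
  have hdim := LinearMap.finrank_le_finrank_of_injective hinj
  rw [Module.finrank_prod, Module.finrank_prod] at hdim
  simp only [Module.finrank_fintype_fun_eq_card] at hdim
  have hP : Fintype.card P ≤ ∑ k, nodalCount A (φ k) := by
    simp only [nodalCount]
    rw [← Finset.card_sigma, ← Finset.card_univ]
    refine Finset.card_le_card_of_injOn (fun q => ⟨q.1.1, q.1.2.1⟩) (fun q _ => ?_) ?_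
    · simpa using ⟨q.1.2.2.1, q.2⟩
    · rintro ⟨⟨k, e⟩, h⟩ _ ⟨⟨k', e'⟩, h'⟩ _ heq
      simp only [Sigma.mk.injEq, heq_eq_eq] at heq
      obtain ⟨rfl, h2⟩ := heq
      obtain rfl := Subtype.ext h2
      rfl
  have hi : Fintype.card {i : Fin n // i ≠ 0} = n - 1 := by
    simp [Fintype.card_subtype_compl]
  omega

end Form

/-! ### Counting edges and indices -/

theorem ncard_edgeSet_eq_card_lt {n : ℕ} (G : SimpleGraph (Fin n)) [DecidableRel G.Adj] :
    G.edgeSet.ncard = Fintype.card {p : Fin n × Fin n // p.1 < p.2 ∧ G.Adj p.1 p.2} := by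
  have h : G.edgeSet = (fun p : Fin n × Fin n => s(p.1, p.2)) ''
      {p : Fin n × Fin n | p.1 < p.2 ∧ G.Adj p.1 p.2} := by
    ext e
    induction e using Sym2.ind with
    | _ i j =>
      simp only [SimpleGraph.mem_edgeSet, Set.mem_image, Set.mem_ofPred_eq, Prod.exists]
      constructor
      · intro h
        rcases lt_or_gt_of_ne h.ne with h' | h'
        · exact ⟨i, j, ⟨h', h⟩, rfl⟩
        · exact ⟨j, i, ⟨h', h.symm⟩, Sym2.eq_swap⟩
      · rintro ⟨a, b, ⟨_, hab⟩, heq⟩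
        rw [← SimpleGraph.mem_edgeSet, ← heq]
        exact hab
  rw [h, Set.InjOn.ncard_image, Set.ncard_eq_toFinset_card', Set.toFinset_card]
  · rfl
  · rintro ⟨a, b⟩ ⟨h1, _⟩ ⟨c, d⟩ ⟨h2, _⟩ heq
    simp only [Sym2.eq_iff] at heq
    rcases heq with ⟨rfl, rfl⟩ | ⟨rfl, rfl⟩
    · rfl
    · exact absurd h1 h2.asymm

theorem card_prod_gt (n : ℕ) :
    Fintype.card {p : Fin n × Fin n // p.2 < p.1} = ∑ k : Fin n, (k : ℕ) := by
  rw [Fintype.card_subtype, Finset.card_filter, Fintype.sum_prod_type]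
  refine Finset.sum_congr rfl fun k _ => ?_
  rw [← Finset.card_filter]
  have : (Finset.univ.filter fun l : Fin n => l < k) = Finset.Iio k := by ext; simp
  rw [this, Fin.card_Iio]

theorem two_mul_sum_fin_val (n : ℕ) :
    2 * ∑ k : Fin n, ((k : ℕ) : ℝ) = (n : ℝ) * ((n : ℝ) - 1) := by
  induction n with
  | zero => simp
  | succ n ih =>
    rw [Fin.sum_univ_castSucc]
    simp only [Fin.val_castSucc, Fin.val_last]
    push_cast
    linarith

/-! ### The bounds, by applying the dimension count to A and −A -/

namespace NodalCount

variable {n : ℕ} {G : SimpleGraph (Fin n)} {A : Matrix (Fin n) (Fin n) ℝ} {lam : Fin n → ℝ}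
  {φ : Fin n → Fin n → ℝ}

theorem IsStrictlySupported.adj_iff (h : IsStrictlySupported G A) {i j : Fin n} (hij : i ≠ j) :
    G.Adj i j ↔ A i j ≠ 0 :=
  ⟨h.2 i j, fun h' => by_contra fun h'' => h' (h.1.2 i j hij h'')⟩

theorem IsStrictlySupported.card_edgePair (h : IsStrictlySupported G A) :
    Fintype.card (EdgePair A) = G.edgeSet.ncard := by
  classical
  rw [ncard_edgeSet_eq_card_lt]
  refine Fintype.card_congr (Equiv.subtypeEquivRight fun p => ?_)
  exact and_congr_right fun hp => (h.adj_iff hp.ne).symm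

theorem IsStrictlySupported.neg (h : IsStrictlySupported G A) : IsStrictlySupported G (-A) :=
  ⟨neg_mem h.1, fun i j hij => neg_ne_zero.mpr (h.2 i j hij)⟩

/-- As v has no zeros, each edge is counted for exactly one of A and −A. -/
theorem nodalCount_add_neg {v : Fin n → ℝ} (hv : ∀ i, v i ≠ 0) :
    nodalCount A v + nodalCount (-A) v = Fintype.card (EdgePair A) := by
  rw [nodalCount, nodalCount, ← Finset.card_union_of_disjoint, Fintype.card_subtype]
  · congr 1
    ext p
    have h1 := hv p.1
    have h2 := hv p.2
    simp only [Matrix.neg_apply, Finset.mem_union, Finset.mem_filter, Finset.mem_univ, true_and,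
      neg_mul, Left.neg_pos_iff, ← and_or_left]
    refine and_congr_right fun _ => ?_
    rw [or_comm, ← ne_iff_lt_or_gt]
    simp [h1, h2]
  · rw [Finset.disjoint_filter]
    rintro p _ ⟨_, h⟩ ⟨_, h'⟩
    simp only [Matrix.neg_apply, neg_mul] at h'
    linarith

theorem IsOrderedEigenbasis.hasEigenvector (h : IsOrderedEigenbasis A lam φ) (k : Fin n) :
    Module.End.HasEigenvector (Matrix.toLin' A) (lam k) (φ k) := by
  refine ⟨?_, fun h0 => ?_⟩
  · rw [Module.End.mem_eigenspace_iff, Matrix.toLin'_apply]; exact h.eigen k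
  · simpa [h0] using h.orthonormal k k

/-- A repeated eigenvalue would put two orthonormal vectors into a one-dimensional eigenspace. -/
theorem IsOrderedEigenbasis.strictMono (hA : NCC G A) (h : IsOrderedEigenbasis A lam φ) :
    StrictMono lam := by
  refine h.monotone.strictMono_of_injective fun j k hjk => by_contra fun hne => ?_
  have h1 := hA.simple _ (Module.End.hasEigenvalue_of_hasEigenvector (h.hasEigenvector j))
  obtain ⟨c, hc⟩ := exists_smul_eq_of_finrank_eq_one h1 (x := ⟨φ j, (h.hasEigenvector j).1⟩)
    (fun h0 => (h.hasEigenvector j).2 (congrArg Subtype.val h0))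
    ⟨φ k, hjk ▸ (h.hasEigenvector k).1⟩
  have hc' : c • φ j = φ k := congrArg Subtype.val hc
  have h2 := h.orthonormal j k
  have h3 := h.orthonormal k k
  rw [← hc', dotProduct_smul, h.orthonormal j j] at h2
  simp [hne] at h2
  simp [← hc', h2] at h3

theorem IsOrderedEigenbasis.neg (h : IsOrderedEigenbasis A lam φ) :
    IsOrderedEigenbasis (-A) (fun k => -lam k.rev) (fun k => φ k.rev) where
  monotone j k hjk := neg_le_neg (h.monotone (Fin.rev_le_rev.mpr hjk))
  orthonormal j k := by simp [h.orthonormal]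
  eigen k := by rw [Matrix.neg_mulVec, h.eigen, neg_smul]

theorem sum_nodalCount_add_neg (hnz : ∀ k i, φ k i ≠ 0) :
    ∑ k, nodalCount A (φ k) + ∑ k : Fin n, nodalCount (-A) (φ k.rev)
      = n * Fintype.card (EdgePair A) := by
  rw [Fintype.sum_equiv Fin.revPerm (fun k : Fin n => nodalCount (-A) (φ k.rev))
    (fun k => nodalCount (-A) (φ k)) (fun k => by simp), ← Finset.sum_add_distrib]
  simp [nodalCount_add_neg (hnz _)]

theorem averageNodalCount_eq :
    averageNodalCount A φ = (1 / (n : ℝ)) * ((∑ k, nodalCount A (φ k) : ℕ) : ℝ) := by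
  simp [averageNodalCount]

theorem averageNodalSurplus_eq :
    averageNodalSurplus A φ = (1 / (n : ℝ)) *
      (((∑ k, nodalCount A (φ k) : ℕ) : ℝ) - (n : ℝ) * ((n : ℝ) - 1) / 2) := by
  rw [averageNodalSurplus, Finset.sum_sub_distrib, ← two_mul_sum_fin_val]
  push_cast
  ring

theorem NCC.le_sum_nodalCount [NeZero n] (hA : NCC G A) (h : IsOrderedEigenbasis A lam φ) :
    (betti G : ℝ) + (n : ℝ) * ((n : ℝ) - 1) / 2 ≤ ((∑ k, nodalCount A (φ k) : ℕ) : ℝ) := by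
  have h1 := edges_add_le_sum_nodalCount hA.strictlySupported.1.1 (h.strictMono hA) h.orthonormal
    h.eigen (fun k => hA.nowhereVanishing _ _ (h.hasEigenvector k))
  rw [hA.strictlySupported.card_edgePair, card_prod_gt] at h1
  have h2 : (G.edgeSet.ncard : ℝ) + ∑ k : Fin n, ((k : ℕ) : ℝ)
      ≤ ((∑ k, nodalCount A (φ k) : ℕ) : ℝ) + ((n - 1 : ℕ) : ℝ) := by exact_mod_cast h1
  have h3 := two_mul_sum_fin_val n
  rw [Nat.cast_sub (NeZero.one_le), Nat.cast_one] at h2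
  rw [betti]
  push_cast at h2 ⊢
  linarith

theorem NCC.neg (hA : NCC G A) : NCC G (-A) := by
  have key : ∀ μ : ℝ, Module.End.eigenspace (Matrix.toLin' (-A)) μ
      = Module.End.eigenspace (Matrix.toLin' A) (-μ) := fun μ => by
    ext v
    simp only [Module.End.mem_eigenspace_iff, Matrix.toLin'_apply, Matrix.neg_mulVec, neg_smul]
    rw [neg_eq_iff_eq_neg]
  refine ⟨hA.strictlySupported.neg, fun μ hμ => ?_, fun μ v hv => ?_⟩
  · rw [key]
    refine hA.simple _ ?_
    rw [Module.End.hasEigenvalue_iff] at hμ ⊢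
    rwa [← key]
  · refine hA.nowhereVanishing (-μ) v ⟨?_, hv.2⟩
    exact (key μ).le hv.1

/-- This is the lower bound for −A, whose ordered eigenbasis is the reversed one, combined with the
edge total n |E|. -/
theorem NCC.sum_nodalCount_le [NeZero n] (hA : NCC G A) (h : IsOrderedEigenbasis A lam φ) :
    ((∑ k, nodalCount A (φ k) : ℕ) : ℝ)
      ≤ (n : ℝ) * (betti G : ℝ) - betti G + (n : ℝ) * ((n : ℝ) - 1) / 2 := by
  have h1 := hA.neg.le_sum_nodalCount h.neg
  have h2 := sum_nodalCount_add_neg (A := A) (φ := φ)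
    (fun k => hA.nowhereVanishing _ _ (h.hasEigenvector k))
  have h3 : ((∑ k, nodalCount A (φ k) : ℕ) : ℝ) + ((∑ k : Fin n, nodalCount (-A) (φ k.rev) : ℕ) : ℝ)
      = n * (G.edgeSet.ncard : ℝ) := by
    rw [← hA.strictlySupported.card_edgePair]; exact_mod_cast h2
  have h4 : (betti G : ℝ) = (G.edgeSet.ncard : ℝ) - ((n : ℝ) - 1) := by simp [betti]
  have h5 : (G.edgeSet.ncard : ℝ) = betti G + ((n : ℝ) - 1) := by linarith
  rw [h5] at h3
  nlinarith

theorem NCC.averageNodalSurplus_bounds [NeZero n] (hA : NCC G A)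
    (h : IsOrderedEigenbasis A lam φ) :
    ((betti G : ℝ) / n ≤ averageNodalSurplus A φ ∧
      averageNodalSurplus A φ ≤ (betti G : ℝ) - (betti G : ℝ) / n) ∧
    (((n : ℝ) - 1) / 2 + (betti G : ℝ) / n ≤ averageNodalCount A φ ∧
      averageNodalCount A φ ≤ ((n : ℝ) - 1) / 2 + (betti G : ℝ) - (betti G : ℝ) / n) := by
  have hn : (0 : ℝ) < n := by exact_mod_cast Nat.pos_of_neZero n
  have h1 := hA.le_sum_nodalCount h
  have h2 := hA.sum_nodalCount_le h
  rw [averageNodalSurplus_eq, averageNodalCount_eq]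
  set S := ((∑ k, nodalCount A (φ k) : ℕ) : ℝ)
  refine ⟨⟨?_, ?_⟩, ?_, ?_⟩
  all_goals
    rw [← mul_le_mul_iff_right₀ hn]
    field_simp
    linarith

end NodalCount

/-! ### Stability of a simple eigenbasis under perturbation -/

/-- `φ` is an orthonormal eigenbasis of the symmetric matrix `A`, with the pairwise distinct
eigenvalues `lam`. -/
structure IsSimpleEigenbasis {V : Type*} [Fintype V] [DecidableEq V] (A : Matrix V V ℝ)
    (lam : V → ℝ) (φ : V → V → ℝ) : Prop where
  symm : A.IsSymm
  injective : Function.Injective lam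
  orthonormal : ∀ j k, φ j ⬝ᵥ φ k = if j = k then 1 else 0
  eigen : ∀ k, A.mulVec (φ k) = lam k • φ k

theorem dotProduct_mulVec_of_isSymm {V : Type*} [Fintype V]
    {A : Matrix V V ℝ} (hA : A.IsSymm) (v w : V → ℝ) :
    v ⬝ᵥ A.mulVec w = A.mulVec v ⬝ᵥ w := by
  rw [Matrix.dotProduct_mulVec, ← Matrix.mulVec_transpose, hA.eq]

section Perturbation

variable {V : Type*} [Fintype V] [DecidableEq V]

theorem sum_dotProduct_mul_of_orthonormal {φ : V → V → ℝ}
    (h : ∀ j k, φ j ⬝ᵥ φ k = if j = k then 1 else 0) (v : V → ℝ) (i : V) :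
    ∑ k, (φ k ⬝ᵥ v) * φ k i = v i := by
  simp only [dotProduct, Finset.sum_mul]
  rw [Finset.sum_comm]
  have : ∀ j, ∑ k, φ k j * v j * φ k i = v j * ∑ k, φ k j * φ k i := fun j => by
    rw [Finset.mul_sum]; exact Finset.sum_congr rfl fun k _ => by ring
  simp [this, sum_mul_eq_of_orthonormal h]

theorem sum_sq_dotProduct_of_orthonormal {φ : V → V → ℝ}
    (h : ∀ j k, φ j ⬝ᵥ φ k = if j = k then 1 else 0) (v : V → ℝ) :
    ∑ k, (φ k ⬝ᵥ v) ^ 2 = v ⬝ᵥ v := by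
  conv_rhs => rw [dotProduct]
  have : ∀ i, v i * v i = ∑ k, (φ k ⬝ᵥ v) * (v i * φ k i) := fun i => by
    nth_rewrite 1 [← sum_dotProduct_mul_of_orthonormal h v i]
    rw [Finset.sum_mul]; exact Finset.sum_congr rfl fun k _ => by ring
  simp only [this]
  rw [Finset.sum_comm]
  refine Finset.sum_congr rfl fun k _ => ?_
  rw [← Finset.mul_sum, sq, dotProduct_comm (φ k) v]
  rfl

theorem exists_orthonormal_eigenbasis {B : Matrix V V ℝ} (hB : B.IsSymm) :
    ∃ (μ : V → ℝ) (ψ : V → V → ℝ), (∀ j k, ψ j ⬝ᵥ ψ k = if j = k then 1 else 0) ∧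
      ∀ k, B.mulVec (ψ k) = μ k • ψ k := by
  have hH : B.IsHermitian := by
    rw [Matrix.IsHermitian, Matrix.conjTranspose_eq_transpose_of_trivial]; exact hB
  refine ⟨hH.eigenvalues, fun k => (hH.eigenvectorBasis k).ofLp, fun j k => ?_, fun k => ?_⟩
  · have := orthonormal_iff_ite.mp hH.eigenvectorBasis.orthonormal k j
    rw [EuclideanSpace.inner_eq_star_dotProduct] at this
    simpa [eq_comm] using this
  · exact hH.mulVec_eigenvectorBasis k

variable {A : Matrix V V ℝ} {lam : V → ℝ} {φ : V → V → ℝ}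

theorem exists_gap (h : Function.Injective lam) :
    ∃ g > 0, ∀ j k, j ≠ k → g ≤ |lam j - lam k| := by
  by_cases hne : (Finset.univ.filter fun p : V × V => p.1 ≠ p.2).Nonempty
  · obtain ⟨p, hp, hmin⟩ := Finset.exists_min_image _ (fun p : V × V => |lam p.1 - lam p.2|) hne
    refine ⟨|lam p.1 - lam p.2|, ?_, fun j k hjk => hmin (j, k) (by simpa using hjk)⟩
    exact abs_pos.mpr (sub_ne_zero.mpr fun h' => (Finset.mem_filter.mp hp).2 (h h'))
  · refine ⟨1, one_pos, fun j k hjk => absurd ⟨(j, k), ?_⟩ hne⟩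
    simpa using hjk

/-- A matrix with small residuals at a simple eigenbasis has a simple eigenbasis nearby. -/
theorem IsSimpleEigenbasis.exists_near_of_residual (h : IsSimpleEigenbasis A lam φ) {g δ : ℝ}
    (hg : ∀ j k, j ≠ k → g ≤ |lam j - lam k|) (hδ : 0 < δ) (hδg : 4 * δ ≤ g)
    {B : Matrix V V ℝ} (hB : B.IsSymm)
    (hres : ∀ k, (B.mulVec (φ k) - lam k • φ k) ⬝ᵥ (B.mulVec (φ k) - lam k • φ k) < δ ^ 2) :
    ∃ lam' φ', IsSimpleEigenbasis B lam' φ' ∧ (∀ k, |lam' k - lam k| < δ) ∧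
      ∀ k i, |φ' k i - φ k i| ≤ 4 * δ / g := by
  have hg0 : 0 < g := by linarith
  obtain ⟨μ, ψ, hψ, hBψ⟩ := exists_orthonormal_eigenbasis hB
  have hcoef : ∀ k j, ψ j ⬝ᵥ (B.mulVec (φ k) - lam k • φ k) = (μ j - lam k) * (ψ j ⬝ᵥ φ k) := by
    intro k j
    rw [dotProduct_sub, dotProduct_mulVec_of_isSymm hB, hBψ, smul_dotProduct, dotProduct_smul]
    simp only [smul_eq_mul]; ring
  have hsum : ∀ k, ∑ j, (μ j - lam k) ^ 2 * (ψ j ⬝ᵥ φ k) ^ 2 < δ ^ 2 := by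
    intro k
    have := hres k
    rw [← sum_sq_dotProduct_of_orthonormal hψ] at this
    simpa only [hcoef, mul_pow] using this
  have hone : ∀ k, ∑ j, (ψ j ⬝ᵥ φ k) ^ 2 = 1 := fun k => by
    rw [sum_sq_dotProduct_of_orthonormal hψ, h.orthonormal, if_pos rfl]
  -- If every eigenvalue of B were at distance at least δ from λ_k, the residual would have norm at
  -- least δ.
  have hex : ∀ k, ∃ j, |μ j - lam k| < δ := by
    intro k
    by_contra hcon
    push Not at hcon
    have : δ ^ 2 * ∑ j, (ψ j ⬝ᵥ φ k) ^ 2 ≤ ∑ j, (μ j - lam k) ^ 2 * (ψ j ⬝ᵥ φ k) ^ 2 := by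
      rw [Finset.mul_sum]
      refine Finset.sum_le_sum fun j _ => mul_le_mul_of_nonneg_right ?_ (sq_nonneg _)
      rw [← sq_abs (μ j - lam k)]
      exact pow_le_pow_left₀ hδ.le (hcon j) 2
    rw [hone, mul_one] at this
    exact absurd (hsum k) (not_lt.mpr this)
  choose e he using hex
  have hinj : Function.Injective e := by
    intro k k' hkk
    by_contra hne
    have h1 := he k
    have h2 := he k'
    rw [← hkk] at h2
    have h3 := hg k k' hne
    have h4 : |lam k - lam k'| ≤ |μ (e k) - lam k'| + |μ (e k) - lam k| := by
      have := abs_sub (μ (e k) - lam k') (μ (e k) - lam k)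
      simpa using this
    linarith
  have hbij : Function.Bijective e := Finite.injective_iff_bijective.mp hinj
  have hfar : ∀ k j, j ≠ e k → g / 2 ≤ |μ j - lam k| := by
    intro k j hj
    obtain ⟨k', rfl⟩ := hbij.2 j
    have h1 := he k'
    have h3 := hg k k' (fun h' => hj (h' ▸ rfl))
    have h4 : |lam k - lam k'| ≤ |μ (e k') - lam k'| + |μ (e k') - lam k| := by
      have := abs_sub (μ (e k') - lam k') (μ (e k') - lam k)
      simpa using this
    linarith
  -- All eigenvalues of B but the matched one are at distance at least g/2 from λ_k, so the mass of
  -- φ_k on the other eigenvectors is at most (δ / (g/2))².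
  have hc : ∀ k, 1 - (ψ (e k) ⬝ᵥ φ k) ^ 2 ≤ 4 * δ ^ 2 / g ^ 2 := by
    intro k
    have h1 : 1 - (ψ (e k) ⬝ᵥ φ k) ^ 2 = ∑ j ∈ Finset.univ.erase (e k), (ψ j ⬝ᵥ φ k) ^ 2 := by
      rw [← hone k, ← Finset.add_sum_erase _ _ (Finset.mem_univ (e k))]; ring
    have h2 : (g / 2) ^ 2 * ∑ j ∈ Finset.univ.erase (e k), (ψ j ⬝ᵥ φ k) ^ 2
        ≤ ∑ j, (μ j - lam k) ^ 2 * (ψ j ⬝ᵥ φ k) ^ 2 := by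
      rw [Finset.mul_sum]
      refine (Finset.sum_le_sum fun j hj => ?_).trans (Finset.sum_le_sum_of_subset_of_nonneg
        (Finset.subset_univ (Finset.univ.erase (e k))) fun j _ _ => by positivity)
      refine mul_le_mul_of_nonneg_right ?_ (sq_nonneg _)
      rw [← sq_abs (μ j - lam k)]
      exact pow_le_pow_left₀ (by positivity) (hfar k j (Finset.ne_of_mem_erase hj)) 2
    rw [h1, le_div_iff₀ (by positivity)]
    have h3 := hsum k
    nlinarith
  -- Eigenvectors are determined only up to sign; s picks the one with nonnegative overlap. The
  -- squared distance is then 2 − 2|c| ≤ 2(1 − c²), with c the overlap.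
  set s : V → ℝ := fun k => if 0 ≤ ψ (e k) ⬝ᵥ φ k then 1 else -1 with hs
  have hs1 : ∀ k, s k * s k = 1 := fun k => by simp only [hs]; split_ifs <;> norm_num
  have hs2 : ∀ k, s k * (ψ (e k) ⬝ᵥ φ k) = |ψ (e k) ⬝ᵥ φ k| := fun k => by
    simp only [hs]
    split_ifs with h'
    · rw [one_mul, abs_of_nonneg h']
    · rw [abs_of_neg (not_le.mp h')]; ring
  refine ⟨fun k => μ (e k), fun k => s k • ψ (e k), ⟨hB, fun k k' hkk => ?_, fun j k => ?_,
    fun k => ?_⟩, he, fun k i => ?_⟩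
  · by_contra hne
    have h1 := he k
    have h2 := hfar k' (e k) (fun h' => hne (hinj h'))
    have h3 := he k'
    rw [show μ (e k) = μ (e k') from hkk] at h2
    linarith
  · rw [smul_dotProduct, dotProduct_smul, hψ]
    by_cases hjk : j = k
    · subst hjk; simp [hs1]
    · simp [hjk, hinj.ne hjk]
  · rw [Matrix.mulVec_smul, hBψ, smul_comm]
  · have h1 : (s k • ψ (e k) - φ k) ⬝ᵥ (s k • ψ (e k) - φ k) = 2 - 2 * |ψ (e k) ⬝ᵥ φ k| := by
      simp only [sub_dotProduct, dotProduct_sub, smul_dotProduct, dotProduct_smul, hψ,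
        h.orthonormal, if_true, smul_eq_mul, mul_one, dotProduct_comm (φ k)]
      linear_combination hs1 k - 2 * hs2 k
    have h2 : (s k • ψ (e k) - φ k) i ^ 2 ≤ (s k • ψ (e k) - φ k) ⬝ᵥ (s k • ψ (e k) - φ k) := by
      rw [sq, dotProduct]
      exact Finset.single_le_sum
        (f := fun i => (s k • ψ (e k) - φ k) i * (s k • ψ (e k) - φ k) i)
        (fun i _ => mul_self_nonneg _) (Finset.mem_univ i)
    have h3 : (ψ (e k) ⬝ᵥ φ k) ^ 2 ≤ 1 := by
      rw [← hone k]
      exact Finset.single_le_sum (f := fun j => (ψ j ⬝ᵥ φ k) ^ 2)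
        (fun i _ => sq_nonneg _) (Finset.mem_univ _)
    have h4 : |ψ (e k) ⬝ᵥ φ k| ≤ 1 := by rwa [← sq_le_one_iff_abs_le_one]
    have h5 : (ψ (e k) ⬝ᵥ φ k) ^ 2 ≤ |ψ (e k) ⬝ᵥ φ k| := by
      rw [← sq_abs]; nlinarith [abs_nonneg (ψ (e k) ⬝ᵥ φ k)]
    have h6 := hc k
    refine abs_le_of_sq_le_sq ?_ (by positivity)
    have h7 : (4 * δ / g) ^ 2 = 4 * (4 * δ ^ 2 / g ^ 2) := by ring
    have h8 : 0 ≤ 4 * δ ^ 2 / g ^ 2 := by positivity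
    rw [h7]
    change (s k • ψ (e k) - φ k) i ^ 2 ≤ _
    linarith

/-- The residuals of the fixed vectors φ_k are continuous in B and vanish at A, so open conditions
on the eigendata persist for nearby symmetric matrices. -/
theorem IsSimpleEigenbasis.eventually_exists (h : IsSimpleEigenbasis A lam φ)
    {p : (V → ℝ) × (V → V → ℝ) → Prop} (hp : ∀ᶠ x in 𝓝 (lam, φ), p x) :
    ∀ᶠ B in 𝓝 A, B.IsSymm → ∃ lam' φ', IsSimpleEigenbasis B lam' φ' ∧ p (lam', φ') := by
  obtain ⟨ε, hε, hball⟩ := Metric.eventually_nhds_iff.mp hp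
  obtain ⟨g, hg0, hg⟩ := exists_gap h.injective
  -- The three bounds separate the eigenvalues, keep their shift at most ε/2, and keep the
  -- eigenvector error 4δ/g at most ε/2.
  set δ := min (g / 4) (min (ε / 2) (ε * g / 8)) with hδ
  have hδ0 : 0 < δ := by positivity
  have h1 : δ ≤ g / 4 := min_le_left _ _
  have h2 : δ ≤ ε / 2 := (min_le_right _ _).trans (min_le_left _ _)
  have h3 : δ ≤ ε * g / 8 := (min_le_right _ _).trans (min_le_right _ _)
  have hcont : ∀ᶠ B in 𝓝 A, ∀ k,
      (B.mulVec (φ k) - lam k • φ k) ⬝ᵥ (B.mulVec (φ k) - lam k • φ k) < δ ^ 2 := by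
    rw [Filter.eventually_all]
    intro k
    have hc : Continuous fun B : Matrix V V ℝ =>
        (B.mulVec (φ k) - lam k • φ k) ⬝ᵥ (B.mulVec (φ k) - lam k • φ k) := by
      have : Continuous fun B : Matrix V V ℝ => B.mulVec (φ k) - lam k • φ k :=
        (continuous_id.matrix_mulVec continuous_const).sub continuous_const
      exact this.dotProduct this
    refine hc.continuousAt.eventually_lt continuousAt_const ?_
    rw [h.eigen, sub_self, dotProduct_zero]
    positivity
  filter_upwards [hcont] with B hB hsymm
  obtain ⟨lam', φ', hb, hl, hf⟩ :=
    h.exists_near_of_residual hg hδ0 (by linarith) hsymm hB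
  refine ⟨lam', φ', hb, hball ?_⟩
  refine lt_of_le_of_lt (b := ε / 2) ?_ (by linarith)
  rw [Prod.dist_eq, max_le_iff]
  refine ⟨(dist_pi_le_iff (by positivity)).mpr fun k => ?_,
    (dist_pi_le_iff (by positivity)).mpr fun k => (dist_pi_le_iff (by positivity)).mpr fun i => ?_⟩
  · rw [Real.dist_eq]; exact (hl k).le.trans h2
  · rw [Real.dist_eq]
    refine (hf k i).trans ?_
    rw [div_le_iff₀ hg0]
    linarith

end Perturbation

/-! ### Bordered matrices: a weakly coupled new vertex -/

section Border

variable {V : Type*}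

/-- The matrix `A` with a row and a column added, with diagonal entry `d` and other entries `b`. -/
def border (d : ℝ) (b : V → ℝ) (A : Matrix V V ℝ) : Matrix (Option V) (Option V) ℝ :=
  Matrix.of fun x y => x.elim (y.elim d b) fun i => y.elim (b i) (A i)

variable {d : ℝ} {b : V → ℝ} {A : Matrix V V ℝ}

@[simp] theorem border_none_none : border d b A none none = d := rfl
@[simp] theorem border_none_some (i : V) : border d b A none (some i) = b i := rfl
@[simp] theorem border_some_none (i : V) : border d b A (some i) none = b i := rfl
@[simp] theorem border_some_some (i j : V) : border d b A (some i) (some j) = A i j := rfl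

theorem border_isSymm (hA : A.IsSymm) : (border d b A).IsSymm := by
  ext x y
  rcases x with _ | i <;> rcases y with _ | j <;> simp [hA.apply]

variable [Fintype V]

theorem border_mulVec_none (v : Option V → ℝ) :
    (border d b A).mulVec v none = d * v none + b ⬝ᵥ fun i => v (some i) := by
  simp [Matrix.mulVec, dotProduct, Fintype.sum_option]

theorem border_mulVec_some (v : Option V → ℝ) (i : V) :
    (border d b A).mulVec v (some i) = b i * v none + A.mulVec (fun i => v (some i)) i := by
  simp [Matrix.mulVec, dotProduct, Fintype.sum_option]

/-- The vector `(d - A)⁻¹ a`, for a matrix `A` with orthonormal eigenbasis `φ`. -/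
noncomputable def resolventVec (lam : V → ℝ) (φ : V → V → ℝ) (a : V → ℝ) (d : ℝ) (i : V) : ℝ :=
  ∑ k, (φ k ⬝ᵥ a) / (d - lam k) * φ k i

theorem eventually_sign_eq {X : Type*} [TopologicalSpace X] {f : X → ℝ} {x : X}
    (hf : ContinuousAt f x) (hx : f x ≠ 0) :
    ∀ᶠ y in 𝓝 x, SignType.sign (f y) = SignType.sign (f x) := by
  have h1 : ContinuousAt (fun y => SignType.sign (f y)) x :=
    ContinuousAt.comp (g := SignType.sign) (continuousAt_sign_of_ne_zero hx) hf
  exact h1.eventually ((isOpen_discrete {SignType.sign (f x)}).mem_nhds rfl)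

variable [DecidableEq V] {lam : V → ℝ} {φ : V → V → ℝ}

/-- The decoupled limit, from which the coupling is switched on. The spectrum remains simple because
d avoids that of A. -/
theorem IsSimpleEigenbasis.border_zero (h : IsSimpleEigenbasis A lam φ) (hd : ∀ k, d ≠ lam k) :
    IsSimpleEigenbasis (border d 0 A) (fun x => x.elim d lam)
      (fun x y => x.elim (y.elim 1 0) fun k => y.elim 0 (φ k)) where
  symm := border_isSymm h.symm
  injective x y hxy := by
    rcases x with _ | j <;> rcases y with _ | k
    · rfl
    · exact absurd hxy (hd k)
    · exact absurd hxy.symm (hd j)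
    · exact congrArg some (h.injective hxy)
  orthonormal x y := by
    rcases x with _ | j <;> rcases y with _ | k
    · simp [dotProduct, Fintype.sum_option]
    · simp [dotProduct, Fintype.sum_option]
    · simp [dotProduct, Fintype.sum_option]
    · simpa [dotProduct, Fintype.sum_option] using h.orthonormal j k
  eigen x := by
    ext y
    rcases y with _ | i
    · rw [border_mulVec_none]
      rcases x with _ | k <;> simp
    · rw [border_mulVec_some]
      rcases x with _ | k
      · simp [Matrix.mulVec, dotProduct]
      · simpa using congrFun (h.eigen k) i

/-- Pairing the lower block of the eigenvalue equation with φ_k determines every coefficient. The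
formula is exact, so it gives signs of entries that vanish in the decoupled limit. -/
theorem IsSimpleEigenbasis.eq_smul_resolventVec (h : IsSimpleEigenbasis A lam φ) {μ : ℝ}
    (hμ : ∀ k, μ ≠ lam k) {v : Option V → ℝ} (hv : (border d b A).mulVec v = μ • v) (i : V) :
    v (some i) = v none * resolventVec lam φ b μ i := by
  have h1 : ∀ k, φ k ⬝ᵥ (fun i => v (some i)) = v none * ((φ k ⬝ᵥ b) / (μ - lam k)) := by
    intro k
    have h2 : A.mulVec (fun i => v (some i)) = μ • (fun i => v (some i)) - v none • b := by
      ext i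
      have := congrFun hv (some i)
      rw [border_mulVec_some] at this
      simp only [Pi.smul_apply, smul_eq_mul, Pi.sub_apply] at this ⊢
      linarith
    have h3 : φ k ⬝ᵥ A.mulVec (fun i => v (some i)) = lam k * (φ k ⬝ᵥ fun i => v (some i)) := by
      rw [dotProduct_mulVec_of_isSymm h.symm, h.eigen, smul_dotProduct, smul_eq_mul]
    rw [h2, dotProduct_sub, dotProduct_smul, dotProduct_smul, smul_eq_mul, smul_eq_mul] at h3
    have h4 : μ - lam k ≠ 0 := sub_ne_zero.mpr (hμ k)
    field_simp
    linarith
  rw [← sum_dotProduct_mul_of_orthonormal h.orthonormal (fun i => v (some i)) i, resolventVec,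
    Finset.mul_sum]
  exact Finset.sum_congr rfl fun k _ => by rw [h1]; ring

/-- Adding a weakly coupled vertex: the old eigenvectors keep their signs, and the signs at the
new vertex and of the new eigenvector are given by first order perturbation theory. -/
theorem IsSimpleEigenbasis.exists_border (h : IsSimpleEigenbasis A lam φ)
    (hnz : ∀ k i, φ k i ≠ 0) {a : V → ℝ} (hd : ∀ k, d ≠ lam k) (ha : ∀ k, φ k ⬝ᵥ a ≠ 0)
    (hψ : ∀ i, resolventVec lam φ a d i ≠ 0) :
    ∃ t : ℝ, 0 < t ∧ ∃ lam₁ φ₁, IsSimpleEigenbasis (border d (t • a) A) lam₁ φ₁ ∧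
      (∀ k i, SignType.sign (φ₁ (some k) (some i)) = SignType.sign (φ k i)) ∧
      (∀ k, SignType.sign (φ₁ (some k) none) =
        SignType.sign (lam k - d) * SignType.sign (φ k ⬝ᵥ a)) ∧
      0 < φ₁ none none ∧
      ∀ i, SignType.sign (φ₁ none (some i)) = SignType.sign (resolventVec lam φ a d i) := by
  set lam₀ : Option V → ℝ := fun x => x.elim d lam with hlam₀
  set φ₀ : Option V → Option V → ℝ :=
    fun x y => x.elim (y.elim 1 0) fun k => y.elim 0 (φ k) with hφ₀
  have hp : ∀ᶠ x : (Option V → ℝ) × (Option V → Option V → ℝ) in 𝓝 (lam₀, φ₀),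
      (∀ k i, SignType.sign (x.2 (some k) (some i)) = SignType.sign (φ k i)) ∧
      (∀ k, SignType.sign ((fun i => x.2 (some k) (some i)) ⬝ᵥ a) = SignType.sign (φ k ⬝ᵥ a)) ∧
      (∀ k, SignType.sign (x.1 (some k) - d) = SignType.sign (lam k - d)) ∧
      0 < x.2 none none ∧ (∀ k, x.1 none ≠ lam k) ∧
      ∀ i, SignType.sign (resolventVec lam φ a (x.1 none) i)
        = SignType.sign (resolventVec lam φ a d i) := by
    refine (eventually_all.mpr fun k => eventually_all.mpr fun i => ?_).and
      ((eventually_all.mpr fun k => ?_).and ((eventually_all.mpr fun k => ?_).and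
      (Eventually.and ?_ ((eventually_all.mpr fun k => ?_).and (eventually_all.mpr fun i => ?_)))))
    · exact eventually_sign_eq (x := (lam₀, φ₀))
        (f := fun x : (Option V → ℝ) × (Option V → Option V → ℝ) => x.2 (some k) (some i))
        (by fun_prop) (hnz k i)
    · exact eventually_sign_eq (x := (lam₀, φ₀))
        (f := fun x : (Option V → ℝ) × (Option V → Option V → ℝ) =>
          (fun i => x.2 (some k) (some i)) ⬝ᵥ a)
        (by simp only [dotProduct]; fun_prop) (ha k)
    · exact eventually_sign_eq (x := (lam₀, φ₀))
        (f := fun x : (Option V → ℝ) × (Option V → Option V → ℝ) => x.1 (some k) - d)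
        (by fun_prop) (sub_ne_zero.mpr (hd k).symm)
    · exact ContinuousAt.eventually_lt (x₀ := (lam₀, φ₀)) continuousAt_const
        (g := fun x : (Option V → ℝ) × (Option V → Option V → ℝ) => x.2 none none)
        (by fun_prop) one_pos
    · exact ContinuousAt.eventually_ne
        (g := fun x : (Option V → ℝ) × (Option V → Option V → ℝ) => x.1 none)
        (by fun_prop) (hd k)
    · refine eventually_sign_eq (x := (lam₀, φ₀))
        (f := fun x : (Option V → ℝ) × (Option V → Option V → ℝ) =>
          resolventVec lam φ a (x.1 none) i) ?_ (hψ i)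
      simp only [resolventVec]
      refine tendsto_finsetSum _ fun k _ => ?_
      refine ContinuousAt.mul (ContinuousAt.div continuousAt_const (by fun_prop) ?_)
        continuousAt_const
      exact sub_ne_zero.mpr (hd k)
  have hev := (h.border_zero hd).eventually_exists hp
  have hcont : Tendsto (fun t : ℝ => border d (t • a) A) (𝓝[>] 0) (𝓝 (border d 0 A)) := by
    have : Continuous fun t : ℝ => border d (t • a) A := by
      refine continuous_matrix fun x y => ?_
      rcases x with _ | i <;> rcases y with _ | j <;> simp <;> fun_prop
    have h2 := this.tendsto 0
    rw [zero_smul] at h2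
    exact h2.mono_left nhdsWithin_le_nhds
  obtain ⟨t, ht1, ht⟩ := ((hcont.eventually hev).and self_mem_nhdsWithin).exists
  have ht : 0 < t := ht
  obtain ⟨lam₁, φ₁, hb, h1, h2, h3, h4, h5, h6⟩ := ht1 (border_isSymm h.symm)
  refine ⟨t, ht, lam₁, φ₁, hb, h1, fun k => ?_, h4, fun i => ?_⟩
  -- This entry tends to 0 with t, so continuity says nothing about its sign. The new row of the
  -- eigenvalue equation expresses it through quantities whose signs are stable.
  · have he := congrFun (hb.eigen (some k)) none
    rw [border_mulVec_none] at he
    have he' : (lam₁ (some k) - d) * φ₁ (some k) none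
        = t * ((fun i => φ₁ (some k) (some i)) ⬝ᵥ a) := by
      rw [smul_dotProduct, dotProduct_comm a] at he
      simp only [Pi.smul_apply, smul_eq_mul] at he
      linarith
    have hs := congrArg SignType.sign he'
    rw [sign_mul, sign_mul, h3, h2, sign_pos ht, one_mul] at hs
    rw [← hs, ← mul_assoc, ← sign_mul, sign_pos (a := (lam k - d) * (lam k - d)), one_mul]
    exact mul_self_pos.mpr (sub_ne_zero.mpr (hd k).symm)
  · rw [h.eq_smul_resolventVec h5 (hb.eigen none) i, sign_mul, sign_pos h4, one_mul, ← h6]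
    have : resolventVec lam φ (t • a) (lam₁ none) i = t * resolventVec lam φ a (lam₁ none) i := by
      simp only [resolventVec, dotProduct_smul, smul_eq_mul, Finset.mul_sum]
      exact Finset.sum_congr rfl fun k _ => by ring
    rw [this, sign_mul, sign_pos ht, one_mul]

end Border

/-! ### Realizations with negative edge weights, and counts of sign changes -/

/-- `A` has negative entries at the edges of `G`, vanishes at the non-edges, and has the simple
eigenbasis `φ`, which vanishes nowhere. -/
structure Realizes {V : Type*} [Fintype V] [DecidableEq V] (G : SimpleGraph V) (A : Matrix V V ℝ)
    (lam : V → ℝ) (φ : V → V → ℝ) : Prop extends IsSimpleEigenbasis A lam φ where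
  ne_zero : ∀ k i, φ k i ≠ 0
  neg_of_adj : ∀ i j, G.Adj i j → A i j < 0
  eq_zero_of_not_adj : ∀ i j, i ≠ j → ¬ G.Adj i j → A i j = 0

section Count

variable {V W : Type*}

open Classical in
/-- The number of ordered pairs of adjacent vertices. -/
noncomputable def dartCount [Fintype V] (G : SimpleGraph V) : ℕ := ∑ i, ∑ j, if G.Adj i j then 1 else 0

open Classical in
/-- The number of ordered pairs of adjacent vertices at which `v` changes sign. -/
noncomputable def signChanges [Fintype V] (G : SimpleGraph V) (v : V → ℝ) : ℕ :=
  ∑ i, ∑ j, if G.Adj i j ∧ v i * v j < 0 then 1 else 0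

/-- The graph `G` with a new vertex which is joined to the vertices in `N`. -/
def addVertex (G : SimpleGraph V) (N : Finset V) : SimpleGraph (Option V) where
  Adj x y := x.elim (y.elim False (· ∈ N)) fun i => y.elim (i ∈ N) (G.Adj i)
  symm := ⟨fun x y h => by
    rcases x with _ | i <;> rcases y with _ | j
    · exact h
    · exact h
    · exact h
    · exact G.symm.symm _ _ h⟩
  loopless := ⟨fun x h => by
    rcases x with _ | i
    · exact h
    · exact G.loopless.irrefl _ h⟩

variable {G : SimpleGraph V} {N : Finset V}

@[simp] theorem addVertex_none_none : ¬ (addVertex G N).Adj none none := id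
@[simp] theorem addVertex_none_some (i : V) : (addVertex G N).Adj none (some i) ↔ i ∈ N := Iff.rfl
@[simp] theorem addVertex_some_none (i : V) : (addVertex G N).Adj (some i) none ↔ i ∈ N := Iff.rfl
@[simp] theorem addVertex_some_some (i j : V) :
    (addVertex G N).Adj (some i) (some j) ↔ G.Adj i j := Iff.rfl

theorem addVertex_connected (hG : G.Connected) (hN : N.Nonempty) : (addVertex G N).Connected := by
  obtain ⟨r, hr⟩ := hN
  rw [SimpleGraph.connected_iff_exists_forall_reachable]
  refine ⟨some r, fun x => ?_⟩
  rcases x with _ | i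
  · exact SimpleGraph.Adj.reachable (show (addVertex G N).Adj (some r) none from hr)
  · let f : G →g addVertex G N := ⟨some, fun h => h⟩
    exact (hG.preconnected r i).map f

variable [Fintype V] [Fintype W]

theorem dartCount_addVertex : dartCount (addVertex G N) = dartCount G + 2 * N.card := by
  classical
  simp only [dartCount, Fintype.sum_option, addVertex_none_none, addVertex_none_some,
    addVertex_some_none, addVertex_some_some, if_false, zero_add, Finset.sum_add_distrib]
  rw [← Finset.card_filter]
  simp only [Finset.filter_univ_mem]
  ring

theorem signChanges_addVertex (v : Option V → ℝ) :
    signChanges (addVertex G N) v = signChanges G (fun i => v (some i))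
      + 2 * ∑ i ∈ N, if v none * v (some i) < 0 then 1 else 0 := by
  classical
  have h : ∑ i ∈ N, (if v none * v (some i) < 0 then 1 else 0)
      = ∑ i, if i ∈ N ∧ v none * v (some i) < 0 then 1 else 0 := by
    rw [← Finset.card_filter, ← Finset.card_filter]
    congr 1
    ext; simp
  rw [h]
  simp only [signChanges, Fintype.sum_option, addVertex_none_none, addVertex_none_some,
    addVertex_some_none, addVertex_some_some, false_and, if_false, zero_add,
    Finset.sum_add_distrib, mul_comm _ (v none)]
  ring

theorem dartCount_comap (e : W ≃ V) : dartCount (G.comap e) = dartCount G := by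
  classical
  simp only [dartCount, SimpleGraph.comap_adj]
  rw [Equiv.sum_comp e (fun i => ∑ j, if G.Adj i (e j) then 1 else 0)]
  exact Finset.sum_congr rfl fun i _ => Equiv.sum_comp e (fun j => if G.Adj i j then 1 else 0)

theorem signChanges_comap (e : W ≃ V) (v : V → ℝ) :
    signChanges (G.comap e) (fun i => v (e i)) = signChanges G v := by
  classical
  simp only [signChanges, SimpleGraph.comap_adj]
  rw [Equiv.sum_comp e (fun i => ∑ j, if G.Adj i (e j) ∧ v i * v (e j) < 0 then 1 else 0)]
  exact Finset.sum_congr rfl fun i _ =>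
    Equiv.sum_comp e (fun j => if G.Adj i j ∧ v i * v j < 0 then 1 else 0)

theorem mul_neg_iff_of_sign_eq {x x' y y' : ℝ} (hx : SignType.sign x = SignType.sign x')
    (hy : SignType.sign y = SignType.sign y') : x * y < 0 ↔ x' * y' < 0 := by
  rw [← sign_eq_neg_one_iff, ← sign_eq_neg_one_iff, sign_mul, sign_mul, hx, hy]

theorem signChanges_congr {v w : V → ℝ}
    (h : ∀ i, SignType.sign (v i) = SignType.sign (w i)) : signChanges G v = signChanges G w := by
  classical
  exact Finset.sum_congr rfl fun i _ => Finset.sum_congr rfl fun j _ =>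
    if_congr (and_congr_right fun _ => mul_neg_iff_of_sign_eq (h i) (h j)) rfl rfl

theorem signChanges_eq_sum {v : V → ℝ} {f : V → V → ℕ}
    (h1 : ∀ i j, G.Adj i j → v i * v j < 0 → f i j = 1)
    (h0 : ∀ i j, ¬ (G.Adj i j ∧ v i * v j < 0) → f i j = 0) :
    signChanges G v = ∑ i, ∑ j, f i j := by
  refine Finset.sum_congr rfl fun i _ => Finset.sum_congr rfl fun j _ => ?_
  split_ifs with h
  · exact (h1 i j h.1 h.2).symm
  · exact (h0 i j h).symm

theorem signChanges_eq_zero {v : V → ℝ} (h : ∀ i j, 0 ≤ v i * v j) : signChanges G v = 0 := by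
  classical
  refine Finset.sum_eq_zero fun i _ => Finset.sum_eq_zero fun j _ => ?_
  rw [if_neg fun h' => absurd h'.2 (not_lt.mpr (h i j))]

theorem signChanges_top_of_single [DecidableEq V] {v : V → ℝ} {r : V} (hr : v r < 0)
    (h : ∀ i, i ≠ r → 0 < v i) :
    signChanges (⊤ : SimpleGraph V) v = 2 * (Fintype.card V - 1) := by
  -- The two summands of f count the ordered pairs that leave r and those that enter r.
  rw [signChanges_eq_sum (f := fun i j => (if i = r then (if j = r then 0 else 1) else 0)
        + (if j = r then (if i = r then 0 else 1) else 0))]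
  rotate_left
  · intro i j hij hv
    rw [SimpleGraph.top_adj] at hij
    by_cases hi : i = r <;> by_cases hj : j = r
    · exact absurd (hi.trans hj.symm) hij
    · simp [hi, hj]
    · simp [hi, hj]
    · exact absurd hv (mul_pos (h i hi) (h j hj)).asymm
  · intro i j hij
    by_cases hi : i = r <;> by_cases hj : j = r
    · simp [hi, hj]
    · subst hi
      exact absurd ⟨fun h' => hj h'.symm, mul_neg_of_neg_of_pos hr (h j hj)⟩ hij
    · subst hj
      exact absurd ⟨hi, mul_neg_of_pos_of_neg (h i hi) hr⟩ hij
    · simp [hi, hj]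
  have h2 : ∑ j, (if j = r then 0 else 1) = Fintype.card V - 1 := by
    have h3 : ∀ j, (if j = r then 0 else 1) = if j ≠ r then 1 else 0 := fun j => by
      by_cases hj : j = r <;> simp [hj]
    simp only [h3]
    rw [← Finset.card_filter, Finset.filter_ne', Finset.card_erase_of_mem (Finset.mem_univ r),
      Finset.card_univ]
  simp only [Finset.sum_add_distrib]
  rw [Finset.sum_comm (f := fun i j => if j = r then (if i = r then 0 else 1) else 0)]
  have h4 : ∑ i, ∑ j, (if i = r then (if j = r then 0 else 1) else 0) = Fintype.card V - 1 := by
    rw [Finset.sum_eq_single r]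
    · simpa using h2
    · intro i _ hi; simp [hi]
    · simp
  rw [h4]; ring

end Count

/-! ### Attaching a vertex whose coupling is dominated by a root -/

section RootedWeight

variable {V : Type*} [DecidableEq V]

/-- The weight of a new vertex which is joined to `r` with weight `-1` and to the other vertices
in `N` with the weight `-ε`. -/
def rootedWeight (N : Finset V) (r : V) (ε : ℝ) (i : V) : ℝ :=
  -(if i = r then 1 else if i ∈ N then ε else 0)

theorem rootedWeight_neg {N : Finset V} {r : V} {ε : ℝ} (hε : 0 < ε) {i : V} (hi : i ∈ N) :
    rootedWeight N r ε i < 0 := by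
  rw [rootedWeight, neg_lt_zero]
  split_ifs
  · exact one_pos
  · exact hε

theorem rootedWeight_eq_zero {N : Finset V} {r : V} (hr : r ∈ N) {ε : ℝ} {i : V} (hi : i ∉ N) :
    rootedWeight N r ε i = 0 := by
  have : i ≠ r := fun h => hi (h ▸ hr)
  simp [rootedWeight, this, hi]

theorem rootedWeight_zero (N : Finset V) (r : V) : rootedWeight N r 0 = -Pi.single r 1 := by
  ext i
  by_cases h : i = r
  · subst h; simp [rootedWeight]
  · simp [rootedWeight, h]

end RootedWeight

section Steps

variable {V : Type*} [Fintype V] [DecidableEq V] {G : SimpleGraph V} {A : Matrix V V ℝ}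
  {lam : V → ℝ} {φ : V → V → ℝ}

theorem Realizes.comap {W : Type*} [Fintype W] [DecidableEq W] (h : Realizes G A lam φ)
    (e : W ≃ V) :
    Realizes (G.comap e) (A.submatrix e e) (fun k => lam (e k)) (fun k i => φ (e k) (e i)) where
  symm := h.symm.submatrix e
  injective := h.injective.comp e.injective
  orthonormal j k := (Equiv.sum_comp e fun i => φ (e j) i * φ (e k) i).trans
    ((h.orthonormal _ _).trans (if_congr e.injective.eq_iff rfl rfl))
  eigen k := by
    ext i
    rw [Pi.smul_apply, ← Pi.smul_apply, ← Pi.smul_apply]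
    have := congrFun (h.eigen (e k)) (e i)
    simp only [Pi.smul_apply] at this ⊢
    rw [← this]
    exact Equiv.sum_comp e fun j => A (e i) j * φ (e k) j
  ne_zero k i := h.ne_zero _ _
  neg_of_adj i j hij := h.neg_of_adj _ _ hij
  eq_zero_of_not_adj i j hij h' := h.eq_zero_of_not_adj _ _ (e.injective.ne hij) h'

/-- The positive factor t preserves the edge signs, and the sign formulas show that the new
eigenvectors have no zeros. -/
theorem Realizes.addVertex (h : Realizes G A lam φ) {N : Finset V} {a : V → ℝ} {d : ℝ}
    (haN : ∀ i ∈ N, a i < 0) (haN' : ∀ i ∉ N, a i = 0) (hd : ∀ k, d ≠ lam k)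
    (ha : ∀ k, φ k ⬝ᵥ a ≠ 0) (hψ : ∀ i, resolventVec lam φ a d i ≠ 0) :
    ∃ A₁ lam₁ φ₁, Realizes (addVertex G N) A₁ lam₁ φ₁ ∧
      (∀ k i, SignType.sign (φ₁ (some k) (some i)) = SignType.sign (φ k i)) ∧
      (∀ k, SignType.sign (φ₁ (some k) none) =
        SignType.sign (lam k - d) * SignType.sign (φ k ⬝ᵥ a)) ∧
      0 < φ₁ none none ∧
      ∀ i, SignType.sign (φ₁ none (some i)) = SignType.sign (resolventVec lam φ a d i) := by
  obtain ⟨t, ht, lam₁, φ₁, hb, h1, h2, h3, h4⟩ := h.exists_border h.ne_zero hd ha hψ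
  refine ⟨_, lam₁, φ₁, ⟨hb, ?_, ?_, ?_⟩, h1, h2, h3, h4⟩
  · intro x y
    rw [← sign_ne_zero]
    rcases x with _ | k <;> rcases y with _ | i
    · rw [sign_ne_zero]; exact h3.ne'
    · rw [h4, sign_ne_zero]; exact hψ i
    · rw [h2, ← sign_mul, sign_ne_zero]
      exact mul_ne_zero (sub_ne_zero.mpr (hd k).symm) (ha k)
    · rw [h1, sign_ne_zero]; exact h.ne_zero k i
  · intro x y hxy
    rcases x with _ | i <;> rcases y with _ | j
    · exact absurd hxy id
    · exact mul_neg_of_pos_of_neg ht (haN j hxy)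
    · exact mul_neg_of_pos_of_neg ht (haN i hxy)
    · exact h.neg_of_adj i j hxy
  · intro x y hne hxy
    rcases x with _ | i <;> rcases y with _ | j
    · exact absurd rfl hne
    · exact mul_eq_zero_of_right t (haN' j hxy)
    · exact mul_eq_zero_of_right t (haN' i hxy)
    · exact h.eq_zero_of_not_adj i j (fun h' => hne (h' ▸ rfl)) hxy

theorem tendsto_div_sub_atTop (c : ℝ) : Tendsto (fun d : ℝ => d / (d - c)) atTop (𝓝 1) := by
  have h1 : Tendsto (fun d : ℝ => 1 + c / (d - c)) atTop (𝓝 (1 + 0)) :=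
    tendsto_const_nhds.add
      (Tendsto.div_atTop tendsto_const_nhds (tendsto_atTop_add_const_right _ (-c) tendsto_id))
  rw [add_zero] at h1
  refine h1.congr' ?_
  filter_upwards [eventually_gt_atTop c] with d hd
  have : d - c ≠ 0 := by linarith
  field_simp
  ring

/-- The leading term of (d − A)⁻¹ a = a/d + A a/d² + ⋯ at infinity. -/
theorem IsSimpleEigenbasis.tendsto_mul_resolventVec (h : IsSimpleEigenbasis A lam φ) (a : V → ℝ)
    (i : V) : Tendsto (fun d => d * resolventVec lam φ a d i) atTop (𝓝 (a i)) := by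
  have h1 : Tendsto (fun d => ∑ k, (φ k ⬝ᵥ a) * φ k i * (d / (d - lam k))) atTop
      (𝓝 (∑ k, (φ k ⬝ᵥ a) * φ k i * 1)) :=
    tendsto_finsetSum _ fun k _ => (tendsto_div_sub_atTop (lam k)).const_mul _
  simp only [mul_one, sum_dotProduct_mul_of_orthonormal h.orthonormal] at h1
  refine h1.congr fun d => ?_
  rw [resolventVec, Finset.mul_sum]
  exact Finset.sum_congr rfl fun k _ => by ring

/-- The second term of the expansion at infinity, which decides the sign where a vanishes. -/
theorem IsSimpleEigenbasis.tendsto_sq_mul_resolventVec (h : IsSimpleEigenbasis A lam φ)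
    {a : V → ℝ} {i : V} (hi : a i = 0) :
    Tendsto (fun d => d ^ 2 * resolventVec lam φ a d i) atTop (𝓝 (A.mulVec a i)) := by
  have h1 : Tendsto (fun d => ∑ k, (φ k ⬝ᵥ A.mulVec a) * φ k i * (d / (d - lam k))) atTop
      (𝓝 (∑ k, (φ k ⬝ᵥ A.mulVec a) * φ k i * 1)) :=
    tendsto_finsetSum _ fun k _ => (tendsto_div_sub_atTop (lam k)).const_mul _
  simp only [mul_one, sum_dotProduct_mul_of_orthonormal h.orthonormal] at h1
  refine h1.congr' ?_
  filter_upwards [eventually_all.mpr fun k => eventually_gt_atTop (lam k)] with d hd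
  have h2 : d ^ 2 * resolventVec lam φ a d i
      = d * ∑ k, ((φ k ⬝ᵥ a) * φ k i * (d / (d - lam k)) - (φ k ⬝ᵥ a) * φ k i) := by
    rw [Finset.sum_sub_distrib, sum_dotProduct_mul_of_orthonormal h.orthonormal, hi, sub_zero,
      resolventVec, Finset.mul_sum, Finset.mul_sum]
    exact Finset.sum_congr rfl fun k _ => by ring
  rw [h2, Finset.mul_sum]
  refine Finset.sum_congr rfl fun k _ => ?_
  rw [dotProduct_mulVec_of_isSymm h.symm, h.eigen, smul_dotProduct, smul_eq_mul]
  have : d - lam k ≠ 0 := sub_ne_zero.mpr (hd k).ne'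
  field_simp
  ring

theorem IsSimpleEigenbasis.mulVec_resolventVec (h : IsSimpleEigenbasis A lam φ) (a : V → ℝ)
    {d : ℝ} (hd : ∀ k, d ≠ lam k) :
    A.mulVec (resolventVec lam φ a d) = d • resolventVec lam φ a d - a := by
  have h0 : resolventVec lam φ a d = ∑ k, ((φ k ⬝ᵥ a) / (d - lam k)) • φ k := by
    ext i; simp [resolventVec]
  ext i
  rw [h0, Matrix.mulVec_sum]
  simp only [Matrix.mulVec_smul, h.eigen, Finset.sum_apply, Pi.sub_apply, Pi.smul_apply,
    smul_eq_mul, Finset.mul_sum]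
  rw [← sum_dotProduct_mul_of_orthonormal h.orthonormal a i, ← Finset.sum_sub_distrib]
  refine Finset.sum_congr rfl fun k _ => ?_
  have : d - lam k ≠ 0 := sub_ne_zero.mpr (hd k)
  field_simp
  ring

theorem continuous_dotProduct_rootedWeight (v : V → ℝ) (N : Finset V) (r : V) :
    Continuous fun ε => v ⬝ᵥ rootedWeight N r ε := by
  simp only [dotProduct, rootedWeight]
  refine continuous_finsetSum _ fun i _ => ?_
  split_ifs <;> fun_prop

/-- At ε = 0 the pairing is −φ_k(r), which is nonzero, and it depends continuously on ε. -/
theorem eventually_sign_dotProduct_rootedWeight (hnz : ∀ k i, φ k i ≠ 0) (N : Finset V) (r : V) :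
    ∀ᶠ ε in 𝓝[>] (0 : ℝ), ∀ k,
      SignType.sign (φ k ⬝ᵥ rootedWeight N r ε) = -SignType.sign (φ k r) := by
  refine Filter.Eventually.filter_mono nhdsWithin_le_nhds (eventually_all.mpr fun k => ?_)
  have h0 : φ k ⬝ᵥ rootedWeight N r 0 = -φ k r := by
    rw [rootedWeight_zero, dotProduct_neg, dotProduct_single, mul_one]
  have := eventually_sign_eq (continuous_dotProduct_rootedWeight (φ k) N r).continuousAt
    (x := 0) (by rw [h0]; exact neg_ne_zero.mpr (hnz k r))
  rwa [h0, Left.sign_neg] at this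

/-- Adding a vertex on top of the spectrum, with coupling dominated by the root `r`. -/
theorem Realizes.addVertex_rooted (h : Realizes G A lam φ) {N : Finset V} {r : V} (hr : r ∈ N)
    {ε d : ℝ} (hε : 0 < ε) (hd : ∀ k, lam k < d)
    (hdot : ∀ k, SignType.sign (φ k ⬝ᵥ rootedWeight N r ε) = -SignType.sign (φ k r))
    (hψ : ∀ i, resolventVec lam φ (rootedWeight N r ε) d i ≠ 0) :
    ∃ A₁ lam₁ φ₁, Realizes (_root_.addVertex G N) A₁ lam₁ φ₁ ∧
      (∀ k i, SignType.sign (φ₁ (some k) (some i)) = SignType.sign (φ k i)) ∧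
      (∀ k, SignType.sign (φ₁ (some k) none) = SignType.sign (φ k r)) ∧
      0 < φ₁ none none ∧
      ∀ i, SignType.sign (φ₁ none (some i))
        = SignType.sign (resolventVec lam φ (rootedWeight N r ε) d i) := by
  obtain ⟨A₁, lam₁, φ₁, h0, h1, h2, h3, h4⟩ := h.addVertex (N := N)
    (fun i hi => rootedWeight_neg hε hi) (fun i hi => rootedWeight_eq_zero hr hi)
    (fun k => (hd k).ne') (fun k => by
      rw [← sign_ne_zero, hdot, ← Left.sign_neg, sign_ne_zero]
      exact neg_ne_zero.mpr (h.ne_zero k r)) hψ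
  refine ⟨A₁, lam₁, φ₁, h0, h1, fun k => ?_, h3, h4⟩
  rw [h2, hdot, sign_neg (sub_neg.mpr (hd k))]
  simp

/-- All neighbours of the new vertex have in each old eigenvector the sign of the root, with a
single exception for each neighbour. -/
theorem sum_signChanges_rooted {N : Finset V} {r : V} (hr : r ∈ N)
    (hone : ∀ i, i ≠ r → ∑ k, (if φ k i * φ k r < 0 then 1 else 0) = 1)
    {φ₁ : Option V → Option V → ℝ}
    (h1 : ∀ k i, SignType.sign (φ₁ (some k) (some i)) = SignType.sign (φ k i))
    (h2 : ∀ k, SignType.sign (φ₁ (some k) none) = SignType.sign (φ k r)) :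
    ∑ x, signChanges (addVertex G N) (φ₁ x)
      = signChanges (addVertex G N) (φ₁ none) + ∑ k, signChanges G (φ k) + 2 * (N.card - 1) := by
  rw [Fintype.sum_option, add_assoc]
  congr 1
  simp only [signChanges_addVertex, Finset.sum_add_distrib]
  congr 1
  · exact Finset.sum_congr rfl fun k _ => signChanges_congr (h1 k)
  · rw [← Finset.mul_sum, Finset.sum_comm]
    congr 1
    simp only [mul_neg_iff_of_sign_eq (h2 _) (h1 _ _)]
    rw [← Finset.add_sum_erase _ _ hr, Finset.sum_eq_zero
      (fun k _ => if_neg (not_lt.mpr (mul_self_nonneg _))), zero_add,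
      Finset.sum_congr rfl (g := fun _ => 1), Finset.sum_const, Finset.card_erase_of_mem hr]
    · simp
    · intro i hi
      refine (Finset.sum_congr rfl fun k _ => ?_).trans (hone i (Finset.ne_of_mem_erase hi))
      exact if_congr (by rw [mul_comm]) rfl rfl

end Steps

theorem addVertex_top_univ {V : Type*} [Fintype V] : addVertex (⊤ : SimpleGraph V) Finset.univ = ⊤ := by
  ext x y
  rcases x with _ | i <;> rcases y with _ | j <;> simp

theorem comap_top_equiv {V W : Type*} (e : W ≃ V) : (⊤ : SimpleGraph V).comap e = ⊤ := by
  ext x y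
  simp

/-! ### Complete graphs, one vertex at a time -/

section Clique

variable {V W : Type*} [Fintype V] [DecidableEq V] [Fintype W] [DecidableEq W]

/-- The complete graph on `V` is realized with an eigenbasis for which every vertex other than
`r` has exactly once the sign opposite to that of `r`. -/
def RootedClique (V : Type*) [Fintype V] [DecidableEq V] (r : V) : Prop :=
  ∃ A lam φ, Realizes (⊤ : SimpleGraph V) A lam φ ∧
    (∀ i, i ≠ r → ∑ k, (if φ k i * φ k r < 0 then 1 else 0) = 1) ∧
    ∑ k, signChanges (⊤ : SimpleGraph V) (φ k) = 2 * (Fintype.card V - 1) ^ 2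

theorem realizes_of_unique [Unique V] (G : SimpleGraph V) :
    Realizes G 0 (fun _ => 0) (fun _ _ => 1) where
  symm := Matrix.isSymm_zero
  injective := Function.injective_of_subsingleton _
  orthonormal j k := by simp [dotProduct, Subsingleton.elim j k]
  eigen k := by simp
  ne_zero _ _ := one_ne_zero
  neg_of_adj i j h := absurd (Subsingleton.elim i j) h.ne
  eq_zero_of_not_adj i j h := absurd (Subsingleton.elim i j) h

theorem RootedClique.of_unique [Unique V] (r : V) : RootedClique V r := by
  refine ⟨_, _, _, realizes_of_unique ⊤, fun i hi => absurd (Subsingleton.elim i r) hi, ?_⟩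
  rw [Fintype.card_unique]
  exact Finset.sum_eq_zero fun k _ => signChanges_eq_zero fun i j => by norm_num

theorem RootedClique.equiv {r : V} (h : RootedClique V r) (e : W ≃ V) {s : W} (hs : e s = r) :
    RootedClique W s := by
  obtain ⟨A, lam, φ, h1, h2, h3⟩ := h
  subst hs
  refine ⟨_, _, _, comap_top_equiv e ▸ h1.comap e, fun i hi => ?_, ?_⟩
  · exact (Equiv.sum_comp e fun k => if φ k (e i) * φ k (e s) < 0 then 1 else 0).trans
      (h2 (e i) (e.injective.ne hi))
  · rw [Fintype.card_congr e, ← h3, ← Equiv.sum_comp e]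
    refine Finset.sum_congr rfl fun k _ => ?_
    rw [← signChanges_comap e, comap_top_equiv]

/-- With ε fixed and d large, the new eigenvector is negative on all p old vertices and positive at
the new one. So the new vertex disagrees with r there only, and old vertices acquire no further
disagreement with r. The halved total grows by (p − 1) + p, from (p − 1)² to p². -/
theorem RootedClique.option {r : V} (h : RootedClique V r) : RootedClique (Option V) (some r) := by
  obtain ⟨A, lam, φ, h, hone, htot⟩ := h
  have hr : r ∈ Finset.univ := Finset.mem_univ r
  obtain ⟨ε, hdot, hε⟩ := ((eventually_sign_dotProduct_rootedWeight h.ne_zero Finset.univ r).and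
    self_mem_nhdsWithin).exists
  have hε : 0 < ε := hε
  have hneg : ∀ i, rootedWeight Finset.univ r ε i < 0 :=
    fun i => rootedWeight_neg hε (Finset.mem_univ i)
  have hev : ∀ᶠ d in atTop, ∀ i,
      d * resolventVec lam φ (rootedWeight Finset.univ r ε) d i < 0 :=
    eventually_all.mpr fun i =>
      (h.tendsto_mul_resolventVec _ i).eventually_lt_const (hneg i)
  obtain ⟨d, ⟨hψ, hd⟩, hd0⟩ := ((hev.and
    (eventually_all.mpr fun k => eventually_gt_atTop (lam k))).and (eventually_gt_atTop 0)).exists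
  have hψ : ∀ i, resolventVec lam φ (rootedWeight Finset.univ r ε) d i < 0 :=
    fun i => by have := hψ i; nlinarith
  obtain ⟨A₁, lam₁, φ₁, h0, h1, h2, h3, h4⟩ :=
    h.addVertex_rooted hr hε hd hdot fun i => (hψ i).ne
  have hnew : ∀ i, φ₁ none (some i) < 0 := fun i => by
    rw [← sign_eq_neg_one_iff, h4, sign_neg (hψ i)]
  have hsum := sum_signChanges_rooted (G := ⊤) hr hone h1 h2
  rw [addVertex_top_univ] at h0 hsum
  refine ⟨A₁, lam₁, φ₁, h0, fun x hx => ?_, ?_⟩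
  · rw [Fintype.sum_option]
    rcases x with _ | i
    · have hold : ∀ k, ¬ φ₁ (some k) none * φ₁ (some k) (some r) < 0 := fun k => by
        rw [mul_neg_iff_of_sign_eq (h2 k) (h1 k r)]
        exact not_lt.mpr (mul_self_nonneg _)
      rw [if_pos (mul_neg_of_pos_of_neg h3 (hnew r)),
        Finset.sum_eq_zero fun k _ => if_neg (hold k), add_zero]
    · rw [if_neg (mul_pos_of_neg_of_neg (hnew i) (hnew r)).asymm, zero_add]
      exact (Finset.sum_congr rfl fun k _ =>
        if_congr (mul_neg_iff_of_sign_eq (h1 k i) (h1 k r)) rfl rfl).trans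
        (hone i fun h' => hx (h' ▸ rfl))
  · rw [hsum, htot, ← addVertex_top_univ, signChanges_addVertex, signChanges_eq_zero
      fun i j => (mul_pos_of_neg_of_neg (hnew i) (hnew j)).le]
    simp only [if_pos (mul_neg_of_pos_of_neg h3 (hnew _)), Finset.sum_const, smul_eq_mul, mul_one,
      Finset.card_univ, Fintype.card_option]
    obtain ⟨p, hp⟩ : ∃ p, Fintype.card V = p + 1 :=
      Nat.exists_eq_add_one.mpr (Fintype.card_pos_iff.mpr ⟨r⟩)
    rw [hp]
    simp only [Nat.add_sub_cancel]
    ring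

theorem rootedClique_fin (p : ℕ) : RootedClique (Fin (p + 1)) (Fin.last p) := by
  induction p with
  | zero => exact RootedClique.of_unique (V := Fin 1) _
  | succ p ih =>
    refine ih.option.equiv (finSuccEquiv (p + 1)) ?_
    rw [← Fin.succ_last, finSuccEquiv_succ]

end Clique

/-! ### Extremal realizations: incomplete cliques and pendant vertices -/

section Extremal

/-- `G` is connected with first Betti number `β`, and it is realized with an eigenbasis of
total nodal surplus `β`. -/
structure Extremal {V : Type*} [Fintype V] [DecidableEq V] (G : SimpleGraph V) (β : ℕ) : Prop where
  connected : G.Connected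
  dartCount_eq : dartCount G + 2 = 2 * (Fintype.card V + β)
  exists_realizes : ∃ A lam φ, Realizes G A lam φ ∧
    ∑ k, signChanges G (φ k) + Fintype.card V = Fintype.card V ^ 2 + 2 * β

variable {V W : Type*} [Fintype V] [DecidableEq V] [Fintype W] [DecidableEq W]

theorem Extremal.comap {G : SimpleGraph V} {β : ℕ} (h : Extremal G β) (e : W ≃ V) :
    Extremal (G.comap e) β where
  connected := (SimpleGraph.Iso.comap e G).connected_iff.mpr h.connected
  dartCount_eq := by rw [dartCount_comap, h.dartCount_eq, Fintype.card_congr e]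
  exists_realizes := by
    obtain ⟨A, lam, φ, h1, h2⟩ := h.exists_realizes
    refine ⟨_, _, _, h1.comap e, ?_⟩
    rw [Fintype.card_congr e, ← h2, ← Equiv.sum_comp e]
    simp only [signChanges_comap]

theorem Extremal.of_unique [Unique V] (G : SimpleGraph V) : Extremal G 0 where
  connected := by
    rw [SimpleGraph.connected_iff_exists_forall_reachable]
    exact ⟨default, fun w => Subsingleton.elim default w ▸ SimpleGraph.Reachable.refl _⟩
  dartCount_eq := by
    have : dartCount G = 0 := Finset.sum_eq_zero fun i _ => Finset.sum_eq_zero fun j _ =>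
      if_neg fun h => h.ne (Subsingleton.elim i j)
    rw [this]; simp
  exists_realizes := by
    refine ⟨_, _, _, realizes_of_unique G, ?_⟩
    rw [Finset.sum_eq_zero fun k _ => signChanges_eq_zero fun i j => by norm_num]
    simp

theorem dartCount_top : dartCount (⊤ : SimpleGraph V) = Fintype.card V * (Fintype.card V - 1) := by
  have : ∀ i : V, ∑ j, (if i ≠ j then 1 else 0) = Fintype.card V - 1 := fun i => by
    rw [← Finset.card_filter, Finset.filter_ne, Finset.card_erase_of_mem (Finset.mem_univ i),
      Finset.card_univ]
  rw [← smul_eq_mul, ← Finset.card_univ, ← Finset.sum_const]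
  exact Finset.sum_congr rfl fun i _ =>
    (Finset.sum_congr rfl fun j _ => by by_cases hij : i = j <;> simp [hij]).trans (this i)

/-- A vertex joined to a nonempty set of vertices of a clique. -/
theorem RootedClique.extremal {r : V} (h : RootedClique V r) {N : Finset V} (hr : r ∈ N) {β : ℕ}
    (hβ : 2 * (β + Fintype.card V) = Fintype.card V * (Fintype.card V - 1) + 2 * N.card) :
    Extremal (addVertex (⊤ : SimpleGraph V) N) β := by
  obtain ⟨p, hp⟩ : ∃ p, Fintype.card V = p + 1 :=
    Nat.exists_eq_add_one.mpr (Fintype.card_pos_iff.mpr ⟨r⟩)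
  have : Nonempty V := ⟨r⟩
  refine ⟨addVertex_connected SimpleGraph.connected_top ⟨r, hr⟩, ?_, ?_⟩
  · rw [dartCount_addVertex, dartCount_top, Fintype.card_option, ← hβ]
    ring
  obtain ⟨A, lam, φ, h, hone, htot⟩ := h
  have hw0 : rootedWeight N r 0 = -Pi.single r 1 := rootedWeight_zero N r
  -- Here d is chosen at ε = 0, and ε afterwards. Off r the weight vanishes at ε = 0, so the second
  -- order term −A_ir > 0 decides, while at r the resolvent is negative. The new eigenvector thus
  -- changes sign exactly on the edges at r, also when N is not the whole clique.
  have hev : ∀ᶠ d in atTop, ∀ i, i ≠ r →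
      0 < d ^ 2 * resolventVec lam φ (rootedWeight N r 0) d i := by
    refine eventually_all.mpr fun i => ?_
    by_cases hi : i = r
    · exact Eventually.of_forall fun d h' => absurd hi h'
    · have h0 : rootedWeight N r 0 i = 0 := by rw [hw0]; simp [hi]
      have hpos : 0 < A.mulVec (rootedWeight N r 0) i := by
        rw [hw0, Matrix.mulVec_neg, Matrix.mulVec_single_one]
        simpa using h.neg_of_adj i r hi
      exact ((h.tendsto_sq_mul_resolventVec h0).eventually_const_lt hpos).mono fun d hd _ => hd
  have hevr : ∀ᶠ d in atTop, d * resolventVec lam φ (rootedWeight N r 0) d r < 0 :=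
    (h.tendsto_mul_resolventVec _ r).eventually_lt_const (by rw [hw0]; simp)
  obtain ⟨d, ⟨⟨hψ, hψr⟩, hd⟩, hd0⟩ := (((hev.and hevr).and
    (eventually_all.mpr fun k => eventually_gt_atTop (lam k))).and (eventually_gt_atTop 0)).exists
  have hcont : ∀ i, Continuous fun ε => resolventVec lam φ (rootedWeight N r ε) d i := fun i =>
    continuous_finsetSum _ fun k _ =>
      ((continuous_dotProduct_rootedWeight (φ k) N r).div_const _).mul continuous_const
  have hevε : ∀ᶠ ε in 𝓝[>] (0 : ℝ),
      (∀ i, i ≠ r → 0 < resolventVec lam φ (rootedWeight N r ε) d i) ∧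
        resolventVec lam φ (rootedWeight N r ε) d r < 0 := by
    refine Filter.Eventually.filter_mono nhdsWithin_le_nhds
      ((eventually_all.mpr fun i => ?_).and ?_)
    · by_cases hi : i = r
      · exact Eventually.of_forall fun ε h' => absurd hi h'
      · exact (((hcont i).tendsto 0).eventually_const_lt
          (pos_of_mul_pos_right (hψ i hi) (by positivity))).mono fun ε hε _ => hε
    · exact ((hcont r).tendsto 0).eventually_lt_const (by nlinarith)
  obtain ⟨ε, ⟨hdot, hpos, hneg⟩, hε⟩ :=
    (((eventually_sign_dotProduct_rootedWeight h.ne_zero N r).and hevε).and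
      self_mem_nhdsWithin).exists
  obtain ⟨A₁, lam₁, φ₁, h0, h1, h2, h3, h4⟩ := h.addVertex_rooted hr hε hd hdot fun i => by
    by_cases hi : i = r
    · exact hi ▸ hneg.ne
    · exact (hpos i hi).ne'
  have hnewr : φ₁ none (some r) < 0 := by rw [← sign_eq_neg_one_iff, h4, sign_neg hneg]
  have hnew : ∀ i, i ≠ r → 0 < φ₁ none (some i) := fun i hi => by
    rw [← sign_eq_one_iff, h4, sign_pos (hpos i hi)]
  refine ⟨A₁, lam₁, φ₁, h0, ?_⟩
  -- The new eigenvector changes sign on the p − 1 clique edges at r and on the edge from r to the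
  -- new vertex.
  rw [sum_signChanges_rooted hr hone h1 h2, htot, signChanges_addVertex,
    signChanges_top_of_single (v := fun i => φ₁ none (some i)) hnewr hnew, Finset.sum_eq_single_of_mem r hr, if_pos
      (mul_neg_of_pos_of_neg h3 hnewr), Fintype.card_option]
  · have hN : 0 < N.card := Finset.card_pos.mpr ⟨r, hr⟩
    obtain ⟨q, hq⟩ : ∃ q, N.card = q + 1 := Nat.exists_eq_add_one.mpr hN
    rw [hp, hq] at hβ ⊢
    simp only [Nat.add_sub_cancel] at hβ ⊢
    nlinarith
  · intro i _ hi
    rw [if_neg (mul_pos h3 (hnew i hi)).asymm]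

/-- A matrix with nonpositive off-diagonal entries and positive row sums is inverse positive. -/
theorem pos_of_mulVec_nonneg {G : SimpleGraph V} (hG : G.Connected) {M : Matrix V V ℝ}
    (hadj : ∀ i j, G.Adj i j → M i j < 0) (hnon : ∀ i j, i ≠ j → ¬ G.Adj i j → M i j = 0)
    (hrow : ∀ i, 0 < ∑ j, M i j) {x : V → ℝ} (hx : ∀ i, 0 ≤ M.mulVec x i) (hx0 : M.mulVec x ≠ 0)
    (i : V) : 0 < x i := by
  have hoff : ∀ i j, i ≠ j → M i j ≤ 0 := fun i j hij => by
    by_cases h : G.Adj i j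
    · exact (hadj i j h).le
    · exact (hnon i j hij h).le
  have : Nonempty V := hG.nonempty
  have hnonneg : ∀ i, 0 ≤ x i := by
    -- At a minimum m of x, the off-diagonal signs give (M x)_m ≤ (row sum) · x_m, so x_m ≥ 0.
    obtain ⟨m, hm⟩ := Finite.exists_min x
    refine fun i => le_trans ?_ (hm i)
    have h1 : M.mulVec x m ≤ (∑ j, M m j) * x m := by
      rw [Finset.sum_mul]
      refine Finset.sum_le_sum fun j _ => ?_
      by_cases hj : m = j
      · rw [hj]
      · exact mul_le_mul_of_nonpos_left (hm j) (hoff m j hj)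
    exact nonneg_of_mul_nonneg_right ((hx m).trans h1) (hrow m)
  -- At a zero of x all terms of its row are nonpositive with nonnegative sum, so x vanishes at all
  -- neighbours. By connectedness a single zero would give x = 0.
  have hstep : ∀ i j, G.Adj i j → x i = 0 → x j = 0 := by
    intro i j hij hi
    have hterm : ∀ k ∈ Finset.univ, M i k * x k ≤ 0 := fun k _ => by
      by_cases hk : i = k
      · rw [← hk, hi, mul_zero]
      · exact mul_nonpos_of_nonpos_of_nonneg (hoff i k hk) (hnonneg k)
    have hsum : ∑ k, M i k * x k = 0 := le_antisymm (Finset.sum_nonpos hterm) (hx i)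
    have := (Finset.sum_eq_zero_iff_of_nonpos hterm).mp hsum j (Finset.mem_univ j)
    exact (mul_eq_zero.mp this).resolve_left (hadj i j hij).ne
  refine (hnonneg i).lt_of_ne' fun hi => hx0 ?_
  have hall : ∀ j, x j = 0 := fun j => by
    obtain ⟨w⟩ := hG.preconnected i j
    induction w with
    | nil => exact hi
    | cons hadj _ ih => exact ih (hstep _ _ hadj hi)
  rw [show x = 0 from funext hall, Matrix.mulVec_zero]

/-- Attaching a pendant vertex. -/
theorem Extremal.pendant {G : SimpleGraph V} {β : ℕ} (h : Extremal G β) (v : V) :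
    Extremal (addVertex G {v}) β := by
  refine ⟨addVertex_connected h.connected (Finset.singleton_nonempty v), ?_, ?_⟩
  · have := h.dartCount_eq
    rw [dartCount_addVertex, Finset.card_singleton, Fintype.card_option]
    omega
  obtain ⟨A, lam, φ, h1, htot⟩ := h.exists_realizes
  -- d lies below the spectrum and below all row sums, so A − d meets the inverse positivity
  -- criterion and the new eigenvector is positive.
  obtain ⟨d, hd, hrow⟩ : ∃ d, (∀ k, d < lam k) ∧ ∀ i, d < ∑ j, A i j :=
    ((eventually_all.mpr fun k => eventually_lt_atBot (lam k)).and
      (eventually_all.mpr fun i => eventually_lt_atBot (∑ j, A i j))).exists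
  set a : V → ℝ := -Pi.single v 1 with ha
  have hdot : ∀ k, φ k ⬝ᵥ a = -φ k v := fun k => by
    rw [ha, dotProduct_neg, dotProduct_single, mul_one]
  have hM : (A - d • (1 : Matrix V V ℝ)).mulVec (resolventVec lam φ a d) = Pi.single v 1 := by
    rw [Matrix.sub_mulVec, Matrix.smul_mulVec, Matrix.one_mulVec,
      h1.mulVec_resolventVec a fun k => (hd k).ne, ha]
    simp
  have hψ : ∀ i, 0 < resolventVec lam φ a d i := by
    refine pos_of_mulVec_nonneg h.connected (M := A - d • (1 : Matrix V V ℝ)) (fun i j hij => ?_)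
      (fun i j hne hij => ?_) (fun i => ?_) (fun i => ?_) ?_
    · simpa [Matrix.one_apply_ne hij.ne] using h1.neg_of_adj i j hij
    · simpa [Matrix.one_apply_ne hne] using h1.eq_zero_of_not_adj i j hne hij
    · simpa [Finset.sum_sub_distrib, Matrix.one_apply] using hrow i
    · rw [hM]
      by_cases hi : i = v
      · subst hi; simp
      · simp [hi]
    · rw [hM]
      exact fun h0 => one_ne_zero (α := ℝ) (by simpa using congrFun h0 v)
  obtain ⟨A₁, lam₁, φ₁, g0, g1, g2, g3, g4⟩ := h1.addVertex (N := {v}) (a := a) (d := d)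
    (fun i hi => by rw [Finset.mem_singleton] at hi; subst hi; simp [ha])
    (fun i hi => by rw [Finset.mem_singleton] at hi; simp [ha, hi])
    (fun k => (hd k).ne) (fun k => by rw [hdot]; exact neg_ne_zero.mpr (h1.ne_zero k v))
    fun i => (hψ i).ne'
  have hnew : ∀ i, 0 < φ₁ none (some i) := fun i => by
    rw [← sign_eq_one_iff, g4, sign_pos (hψ i)]
  -- Since λ_k − d > 0 and ⟨φ_k, a⟩ = −φ_k(v), the pendant edge is a sign change in every old
  -- eigenvector.
  have hold : ∀ k, φ₁ (some k) none * φ₁ (some k) (some v) < 0 := fun k => by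
    have h2 : SignType.sign (φ₁ (some k) none) = SignType.sign (-φ k v) := by
      rw [g2, hdot, sign_pos (sub_pos.mpr (hd k)), one_mul]
    rw [mul_neg_iff_of_sign_eq h2 (g1 k v), neg_mul, neg_lt_zero]
    exact mul_self_pos.mpr (h1.ne_zero k v)
  refine ⟨A₁, lam₁, φ₁, g0, ?_⟩
  rw [Fintype.sum_option]
  simp only [signChanges_addVertex, Finset.sum_singleton, if_pos (hold _),
    if_neg (mul_pos g3 (hnew v)).asymm, signChanges_congr (g1 _), Finset.sum_add_distrib,
    signChanges_eq_zero fun i j => (mul_pos (hnew i) (hnew j)).le, Finset.sum_const,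
    Finset.card_univ, Fintype.card_option, smul_eq_mul]
  nlinarith

end Extremal

/-! ### The graphs of the family as iterated vertex additions -/

/-- The bound on m keeps the last vertex outside the clique, so its only neighbour is its
predecessor. -/
theorem cliquePath_succ {n m : ℕ} (l : ℕ) (hm : m ≤ n + 1) :
    cliquePath (n + 2) m l
      = (addVertex (cliquePath (n + 1) m l) {Fin.last n}).comap finSuccEquivLast := by
  ext a b
  induction a using Fin.lastCases with
  | last =>
    induction b using Fin.lastCases with
    | last => simp
    | cast b =>
      have hb := b.isLt
      simp only [SimpleGraph.comap_adj, finSuccEquivLast_last, finSuccEquivLast_castSucc,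
        addVertex_none_some, Finset.mem_singleton, cliquePath, SimpleGraph.fromRel_adj, ne_eq,
        Fin.ext_iff, Fin.val_last, Fin.val_castSucc]
      omega
  | cast a =>
    have ha := a.isLt
    induction b using Fin.lastCases with
    | last =>
      simp only [SimpleGraph.comap_adj, finSuccEquivLast_last, finSuccEquivLast_castSucc,
        addVertex_some_none, Finset.mem_singleton, cliquePath, SimpleGraph.fromRel_adj, ne_eq,
        Fin.ext_iff, Fin.val_last, Fin.val_castSucc]
      omega
    | cast b =>
      simp only [SimpleGraph.comap_adj, finSuccEquivLast_castSucc,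
        addVertex_some_some, cliquePath, SimpleGraph.fromRel_adj, ne_eq,
        Fin.ext_iff, Fin.val_castSucc]

/-- Vertex 1 plays the role of the added vertex. Element j of `Fin (p + 1)` is vertex j + 2, so the
condition ℓ + 1 < i becomes l ≤ j. -/
theorem cliquePath_self (p l : ℕ) :
    cliquePath (p + 2) (p + 2) l
      = (addVertex (⊤ : SimpleGraph (Fin (p + 1)))
          (Finset.univ.filter fun j => l ≤ (j : ℕ))).comap (finSuccEquiv (p + 1)) := by
  ext a b
  refine Fin.cases ?_ (fun a => ?_) a <;> refine Fin.cases ?_ (fun b => ?_) b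
  · simp
  · have hb := b.isLt
    simp only [SimpleGraph.comap_adj, finSuccEquiv_zero, finSuccEquiv_succ, addVertex_none_some,
      Finset.mem_filter, Finset.mem_univ, true_and, cliquePath, SimpleGraph.fromRel_adj, ne_eq,
      Fin.ext_iff, Fin.val_zero, Fin.val_succ]
    omega
  · have ha := a.isLt
    simp only [SimpleGraph.comap_adj, finSuccEquiv_zero, finSuccEquiv_succ, addVertex_some_none,
      Finset.mem_filter, Finset.mem_univ, true_and, cliquePath, SimpleGraph.fromRel_adj, ne_eq,
      Fin.ext_iff, Fin.val_zero, Fin.val_succ]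
    omega
  · have ha := a.isLt
    have hb := b.isLt
    simp only [SimpleGraph.comap_adj, finSuccEquiv_succ, addVertex_some_some, SimpleGraph.top_adj,
      cliquePath, SimpleGraph.fromRel_adj, ne_eq, Fin.ext_iff, Fin.val_succ]
    omega

theorem extremal_cliquePath {m l β : ℕ} (n : ℕ) (hm : m ≤ n + 1)
    (h : Extremal (cliquePath (n + 1) m l) β) (k : ℕ) :
    Extremal (cliquePath (n + k + 1) m l) β := by
  induction k with
  | zero => exact h
  | succ k ih =>
    have := (ih.pendant (Fin.last (n + k))).comap finSuccEquivLast
    rwa [← cliquePath_succ l (by omega)] at this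

theorem two_mul_choose_two_add (q : ℕ) : 2 * (q + 1).choose 2 = (q + 1) * q := by
  rw [Nat.choose_two_right, Nat.add_sub_cancel, Nat.mul_div_cancel']
  rw [mul_comm]
  exact (Nat.even_mul_succ_self q).two_dvd

theorem extremal_extremizer {n β : ℕ} (hn : 1 ≤ n) (hβ : β ≤ (n - 1).choose 2) :
    Extremal (extremizer n β) β := by
  have hmn : cliqueSize β ≤ n := Nat.sInf_le hβ
  have hle := le_choose_cliqueSize β
  rcases Nat.eq_zero_or_pos β with rfl | hpos
  · have h0 : cliqueSize 0 = 0 := Nat.le_zero.mp (Nat.sInf_le (Nat.zero_le _))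
    obtain ⟨k, rfl⟩ : ∃ k, n = 0 + k + 1 := ⟨n - 1, by omega⟩
    rw [extremizer, h0]
    exact extremal_cliquePath 0 (Nat.zero_le _) (Extremal.of_unique (V := Fin 1) _) k
  · have hlt := choose_cliqueSize_lt hpos
    rw [extremizer]
    generalize cliqueSize β = m at *
    have hm : 3 ≤ m := by
      by_contra hcon
      have : (m - 1).choose 2 = 0 := Nat.choose_eq_zero_of_lt (by omega)
      omega
    obtain ⟨q, rfl⟩ : ∃ q, m = q + 3 := ⟨m - 3, by omega⟩
    obtain ⟨k, rfl⟩ : ∃ k, n = q + 2 + k + 1 := ⟨n - (q + 3), by omega⟩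
    refine extremal_cliquePath (q + 2) le_rfl ?_ k
    simp only [show q + 3 - 1 = q + 2 by omega, show q + 3 - 2 = q + 1 by omega] at *
    have hsucc : (q + 2).choose 2 = (q + 1) + (q + 1).choose 2 := by
      rw [Nat.choose_succ_succ' (q + 1) 1, Nat.choose_one_right]
    have htwo := two_mul_choose_two_add (q + 1)
    set l := (q + 2).choose 2 - β with hl
    -- From (q+1 choose 2) < β. It ensures that the last clique vertex, the root, is joined to
    -- vertex 1.
    have hlq : l ≤ q := by omega
    rw [cliquePath_self (q + 1) l]
    refine (RootedClique.extremal (rootedClique_fin (q + 1)) ?_ ?_).comap _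
    · simp; omega
    · have hcard : (Finset.univ.filter fun j : Fin (q + 1 + 1) => l ≤ (j : ℕ)).card = q + 2 - l := by
        have : (Finset.univ.filter fun j : Fin (q + 1 + 1) => l ≤ (j : ℕ))
            = Finset.Ici (⟨l, by omega⟩ : Fin (q + 1 + 1)) := by
          ext j; simp [Fin.le_def]
        rw [this, Fin.card_Ici]
      rw [hcard, Fintype.card_fin]
      change 2 * (β + (q + 1 + 1)) = (q + 1 + 1) * (q + 1) + 2 * (q + 2 - l)
      rw [← htwo]
      change 2 * (β + (q + 2)) = 2 * (q + 2).choose 2 + 2 * (q + 2 - l)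
      omega

/-! ### Translation to the nodal count condition and to averages -/

section Conclusion

variable {n : ℕ} {G : SimpleGraph (Fin n)} {A : Matrix (Fin n) (Fin n) ℝ} {lam : Fin n → ℝ}
  {φ : Fin n → Fin n → ℝ}

theorem two_mul_ncard_edgeSet (G : SimpleGraph (Fin n)) : 2 * G.edgeSet.ncard = dartCount G := by
  classical
  have h := two_mul_sum_lt (fun i j => if G.Adj i j then (1 : ℝ) else 0)
    (fun i j => by simp only [G.adj_comm i j]) (fun i => by simp)
  rw [ncard_edgeSet_eq_card_lt, Fintype.card_subtype, Finset.card_filter, dartCount]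
  have h' : ((2 * ∑ p : Fin n × Fin n, if p.1 < p.2 ∧ G.Adj p.1 p.2 then 1 else 0 : ℕ) : ℝ)
      = ((∑ i, ∑ j, if G.Adj i j then 1 else 0 : ℕ) : ℝ) := by
    push_cast
    rw [← h]
    simp only [ite_and]
  exact_mod_cast h'

/-- Edge entries are negative, so the counted edges are those where v changes sign. The factor 2
comes from ordered pairs. -/
theorem Realizes.two_mul_nodalCount (h : Realizes G A lam φ) (v : Fin n → ℝ) :
    2 * nodalCount A v = signChanges G v := by
  classical
  have h2 := two_mul_sum_lt (fun i j => if G.Adj i j ∧ v i * v j < 0 then (1 : ℝ) else 0)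
    (fun i j => by simp only [G.adj_comm i j, mul_comm (v i)]) (fun i => by simp)
  have hiff : ∀ i j, i < j → (0 < A i j * v i * v j ↔ G.Adj i j ∧ v i * v j < 0) := by
    intro i j hij
    by_cases hadj : G.Adj i j
    · rw [mul_assoc, ← neg_mul_neg, mul_pos_iff_of_pos_left
        (neg_pos.mpr (h.neg_of_adj i j hadj)), neg_pos]
      simp [hadj]
    · simp [hadj, h.eq_zero_of_not_adj i j hij.ne hadj]
  have hcount : nodalCount A v = ∑ p : Fin n × Fin n,
      if p.1 < p.2 then (if G.Adj p.1 p.2 ∧ v p.1 * v p.2 < 0 then 1 else 0) else 0 := by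
    rw [nodalCount, Finset.card_filter]
    refine Finset.sum_congr rfl fun p _ => ?_
    rw [← ite_and]
    exact if_congr (and_congr_right fun hp => hiff _ _ hp) rfl rfl
  rw [hcount, signChanges]
  exact_mod_cast h2

/-- An eigenvector is orthogonal to each φ_k with a different eigenvalue. As the λ_k are distinct,
it is a nonzero multiple of a single φ_k. -/
theorem Realizes.ncc (h : Realizes G A lam φ) : NCC G A := by
  have key : ∀ (μ : ℝ) (v : Fin n → ℝ), Module.End.HasEigenvector (Matrix.toLin' A) μ v →
      ∃ (k : Fin n) (c : ℝ), μ = lam k ∧ c ≠ 0 ∧ v = c • φ k := by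
    intro μ v hv
    have hAv : A.mulVec v = μ • v := by
      rw [← Matrix.toLin'_apply]; exact Module.End.mem_eigenspace_iff.mp hv.1
    have horth : ∀ k, (μ - lam k) * (φ k ⬝ᵥ v) = 0 := fun k => by
      have := dotProduct_mulVec_of_isSymm h.symm (φ k) v
      rw [hAv, h.eigen, smul_dotProduct, dotProduct_smul, smul_eq_mul, smul_eq_mul] at this
      linarith
    obtain ⟨k, hk⟩ : ∃ k, φ k ⬝ᵥ v ≠ 0 := by
      by_contra hcon
      push Not at hcon
      refine hv.2 (funext fun i => ?_)
      rw [← sum_dotProduct_mul_of_orthonormal h.orthonormal v i]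
      simp [hcon]
    have hμ : μ = lam k := sub_eq_zero.mp ((mul_eq_zero.mp (horth k)).resolve_right hk)
    refine ⟨k, φ k ⬝ᵥ v, hμ, hk, funext fun i => ?_⟩
    rw [← sum_dotProduct_mul_of_orthonormal h.orthonormal v i, Finset.sum_eq_single k]
    · rfl
    · intro j _ hj
      have hne : μ - lam j ≠ 0 := sub_ne_zero.mpr fun h' => hj (h.injective (h'.symm.trans hμ))
      rw [(mul_eq_zero.mp (horth j)).resolve_left hne, zero_mul]
    · simp
  refine ⟨⟨⟨h.symm, h.eq_zero_of_not_adj⟩, fun i j hij => (h.neg_of_adj i j hij).ne⟩, ?_, ?_⟩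
  · intro μ hμ
    obtain ⟨v, hv⟩ := hμ.exists_hasEigenvector
    obtain ⟨k, c, rfl, hc, rfl⟩ := key μ v hv
    refine (finrank_eq_one_iff_of_nonzero' ⟨_, hv.1⟩
      (fun h' => hv.2 (congrArg Subtype.val h'))).mpr fun w => ?_
    by_cases hw : (w : Fin n → ℝ) = 0
    · exact ⟨0, by rw [zero_smul]; exact Subtype.ext hw.symm⟩
    · obtain ⟨j, c', hj, _, hw'⟩ := key _ _ ⟨w.2, hw⟩
      obtain rfl := h.injective hj
      refine ⟨c' / c, Subtype.ext ?_⟩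
      rw [hw']
      change (c' / c) • c • φ k = c' • φ k
      rw [smul_smul, div_mul_cancel₀ _ hc]
  · intro μ v hv i
    obtain ⟨k, c, -, hc, rfl⟩ := key μ v hv
    exact mul_ne_zero hc (h.ne_zero k i)

theorem IsSimpleEigenbasis.isOrderedEigenbasis_sort (h : IsSimpleEigenbasis A lam φ) :
    IsOrderedEigenbasis A (fun k => lam (Tuple.sort lam k)) (fun k => φ (Tuple.sort lam k)) where
  monotone := Tuple.monotone_sort lam
  orthonormal j k := by simp [h.orthonormal]
  eigen k := h.eigen _

theorem Extremal.betti_eq {β : ℕ} (h : Extremal G β) : betti G = β := by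
  have h1 := h.dartCount_eq
  rw [← two_mul_ncard_edgeSet, Fintype.card_fin] at h1
  rw [betti]
  omega

theorem Extremal.exists_attaining [NeZero n] {β : ℕ} (h : Extremal G β) :
    ∃ A ∈ supportedMatrices G,
      (NCC G A ∧ ∃ (lam : Fin n → ℝ) (φ : Fin n → Fin n → ℝ), IsOrderedEigenbasis A lam φ ∧
        averageNodalSurplus A φ = (β : ℝ) / n) ∧
      (NCC G (-A) ∧ ∃ (lam : Fin n → ℝ) (φ : Fin n → Fin n → ℝ), IsOrderedEigenbasis (-A) lam φ ∧
        averageNodalSurplus (-A) φ = (β : ℝ) - (β : ℝ) / n) := by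
  have hbetti := h.betti_eq
  obtain ⟨A, lam, φ, hA, htot⟩ := h.exists_realizes
  have hord := hA.isOrderedEigenbasis_sort
  have hn : (n : ℝ) ≠ 0 := Nat.cast_ne_zero.mpr (NeZero.ne n)
  have hsum : 2 * ((∑ k, nodalCount A (φ (Tuple.sort lam k)) : ℕ) : ℝ) + n = n ^ 2 + 2 * β := by
    have : 2 * ∑ k, nodalCount A (φ (Tuple.sort lam k)) + n = n ^ 2 + 2 * β := by
      -- The total count does not depend on the order of the eigenvectors, so sorting the
      -- eigenvalues leaves it unchanged.
      rw [Equiv.sum_comp (Tuple.sort lam) fun k => nodalCount A (φ k), Finset.mul_sum]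
      simpa [hA.two_mul_nodalCount] using htot
    exact_mod_cast this
  have hneg : ((∑ k, nodalCount A (φ (Tuple.sort lam k)) : ℕ) : ℝ)
      + ((∑ k : Fin n, nodalCount (-A) (φ (Tuple.sort lam k.rev)) : ℕ) : ℝ)
      = n * (β + (n - 1)) := by
    have h1 := sum_nodalCount_add_neg (A := A) (φ := fun k => φ (Tuple.sort lam k))
      fun k => hA.ne_zero _
    rw [hA.ncc.strictlySupported.card_edgePair] at h1
    have h2 : (G.edgeSet.ncard : ℝ) = β + (n - 1) := by
      have : (betti G : ℝ) = β := by rw [hbetti]; simp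
      rw [← this, betti]
      push_cast
      ring
    rw [← h2]
    exact_mod_cast h1
  refine ⟨A, hA.ncc.strictlySupported.1, ⟨hA.ncc, _, _, hord, ?_⟩, hA.ncc.neg, _, _, hord.neg, ?_⟩
  · rw [averageNodalSurplus_eq]
    field_simp
    linarith
  · rw [averageNodalSurplus_eq]
    field_simp
    linarith

end Conclusion

theorem theorem1p1 :
    (∀ (n : ℕ) (G : SimpleGraph (Fin n)), G.Connected →
      ∀ A ∈ supportedMatrices G, NCC G A →
      ∀ (lam : Fin n → ℝ) (φ : Fin n → Fin n → ℝ), IsOrderedEigenbasis A lam φ →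
        ((betti G : ℝ) / n ≤ averageNodalSurplus A φ ∧
          averageNodalSurplus A φ ≤ (betti G : ℝ) - (betti G : ℝ) / n) ∧
        (((n : ℝ) - 1) / 2 + (betti G : ℝ) / n ≤ averageNodalCount A φ ∧
          averageNodalCount A φ ≤
            ((n : ℝ) - 1) / 2 + (betti G : ℝ) - (betti G : ℝ) / n)) ∧
    (∀ n β : ℕ, 1 ≤ n → β ≤ (n - 1).choose 2 →
      (extremizer n β).Connected ∧ betti (extremizer n β) = (β : ℤ) ∧
      ∃ A ∈ supportedMatrices (extremizer n β),
        (NCC (extremizer n β) A ∧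
          ∃ (lam : Fin n → ℝ) (φ : Fin n → Fin n → ℝ), IsOrderedEigenbasis A lam φ ∧
            averageNodalSurplus A φ = (β : ℝ) / n) ∧
        (NCC (extremizer n β) (-A) ∧
          ∃ (lam : Fin n → ℝ) (φ : Fin n → Fin n → ℝ), IsOrderedEigenbasis (-A) lam φ ∧
            averageNodalSurplus (-A) φ = (β : ℝ) - (β : ℝ) / n)) := by
  refine ⟨fun n G hG A _ hA lam φ h => ?_, fun n β hn hβ => ?_⟩
  · have : NeZero n := ⟨fun h0 => by subst h0; exact hG.nonempty.elim Fin.elim0⟩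
    exact hA.averageNodalSurplus_bounds h
  · have : NeZero n := ⟨by omega⟩
    have hext := extremal_extremizer hn hβ
    exact ⟨hext.connected, hext.betti_eq, hext.exists_attaining⟩
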